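/- Let $n\ge 0$ and let $\omega((P,Q),(P',Q'))=\sum_{j=1}^n(P_jQ'_j-P'_jQ_j)$ be the symplectic form on $\mathbb R^{2n}=\{(P,Q)\mid P,Q\in\mathbb R^n\}$, extended complex-bilinearly to $\mathbb C^{2n}$. Let $\mathcal L\subset\mathbb R^{2n}$ be an isotropic linear subspace (that is, $\omega(X,X')=0$ for all $X,X'\in\mathcal L$), with a translation-invariant (Haar) measure $\mu$. For $Y=(P,Q)\in\mathbb C^{2n}$ let $$\Omega(Y)=\sum_{j=1}^n\Bigl(P_j\xi_j-Q_j\tfrac1i\tfrac{\partial}{\partial\xi_j}\Bigr)$$ act on the Schwartz space $\mathcal S(\mathbb R^n)$; for real $X=(P,Q)$ one has $(e^{i\Omega(X)}\varphi)(\xi)=e^{iP\cdot\xi-\frac i2P\cdot Q}\varphi(\xi-Q)$. On $\mathcal S(\mathbb R^n)$ consider the (degenerate) inner product $$\langle\varphi,\psi\rangle=\int_{\mathcal L}d\mu(X)\,(\varphi,e^{i\Omega(X)}\psi),\qquad (\varphi,\psi)=\int_{\mathbb R^n}\overline{\varphi(\xi)}\,\psi(\xi)\,d\xi,$$ with $\|\varphi\|^2=\langle\varphi,\varphi\rangle$,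 and write $\varphi\sim\psi$ if $\|\varphi-\psi\|=0$, that is, if $\varphi$ and $\psi$ define the same vector of the constrained Hilbert space $\overline{\mathcal S(\mathbb R^n)/\!\sim}$. For a complex $n\times n$ matrix $A$ with $\operatorname{Im}\sum_{jk}\xi_jA_{jk}\xi_k>0$ for all $\xi\in\mathbb R^n\setminus\{0\}$, put $\psi_A(\xi)=e^{\frac i2\sum_{jk}\xi_jA_{jk}\xi_k}\in\mathcal S(\mathbb R^n)$ and define the H-germ of $A$ as $$\check r(A)=\{Y\in\mathbb C^{2n}\mid \omega(Y,X)=0\ \text{for all } X\in\mathcal L,\ \text{and } \|\Omega(Y)\psi_A\|=0\}.$$ Let $A^I,A^{II}$ be two such matrices, $c^I,c^{II}\in\mathbb C\setminus\{0\}$, and $\psi^I=c^I\psi_{A^I}$, $\psi^{II}=c^{II}\psi_{A^{II}}$ the corresponding Gaussian states. Then $\check r(A^I)=\check r(A^{II})$ if and only if $\psi^I\sim c\,\psi^{II}$ for some $c\in\mathbb C$. -/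

import Mathlib

open MeasureTheory SchwartzMap
open scoped ComplexConjugate

noncomputable section

namespace Constrained

/-- The phase space `R^{2n}`: a point is a pair `X = (P, Q)`, momenta first. -/
abbrev Phase (R : Type) (n : ℕ) : Type := (Fin n → R) × (Fin n → R)

/-- The embedding of the real phase space into the complexified one. -/
def Phase.toComplex {n : ℕ} (X : Phase ℝ n) : Phase ℂ n :=
  (fun j => (X.1 j : ℂ), fun j => (X.2 j : ℂ))

/-- The symplectic form `ω((P, Q), (P', Q')) = ∑ⱼ (Pⱼ Q'ⱼ - P'ⱼ Qⱼ)`, real or complex bilinear. -/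
def omega {R : Type} [CommRing R] {n : ℕ} (X X' : Phase R n) : R :=
  ∑ j, (X.1 j * X'.2 j - X'.1 j * X.2 j)

/-- An isotropic plane of the real phase space. -/
def IsIsotropic {n : ℕ} (L : Submodule ℝ (Phase ℝ n)) : Prop :=
  ∀ X ∈ L, ∀ X' ∈ L, omega X X' = 0

/-- The coordinate operator `φ ↦ ξⱼ φ` on Schwartz functions. -/
def coordOp {n : ℕ} (j : Fin n) : 𝓢(Fin n → ℝ, ℂ) →L[ℂ] 𝓢(Fin n → ℝ, ℂ) :=
  SchwartzMap.smulLeftCLM ℂ (fun ξ : Fin n → ℝ => (ξ j : ℂ))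

/-- The partial derivative `∂ / ∂ξⱼ` on Schwartz functions. -/
def partialOp {n : ℕ} (j : Fin n) : 𝓢(Fin n → ℝ, ℂ) →L[ℂ] 𝓢(Fin n → ℝ, ℂ) :=
  LineDeriv.lineDerivOpCLM ℂ 𝓢(Fin n → ℝ, ℂ) (Pi.single j 1 : Fin n → ℝ)

/-- `Ω(P, Q) = ∑ⱼ (Pⱼ ξⱼ - Qⱼ (1/i) ∂ⱼ)` for `(P, Q)` in the complexified phase space. -/
def Omega {n : ℕ} (Y : Phase ℂ n) : 𝓢(Fin n → ℝ, ℂ) →L[ℂ] 𝓢(Fin n → ℝ, ℂ) :=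
  ∑ j, (Y.1 j • coordOp j - (Y.2 j * (1 / Complex.I)) • partialOp j)

theorem coord_temperate {n : ℕ} (j : Fin n) :
    Function.HasTemperateGrowth (fun ξ : Fin n → ℝ => (ξ j : ℂ)) :=
  (Complex.ofRealCLM.comp (ContinuousLinearMap.proj (R := ℝ) (φ := fun _ => ℝ) j)).hasTemperateGrowth

theorem Omega_apply {n : ℕ} (Y : Phase ℂ n) (φ : 𝓢(Fin n → ℝ, ℂ)) (ξ : Fin n → ℝ) :
    Omega Y φ ξ = ∑ j, (Y.1 j * ((ξ j : ℂ) * φ ξ)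
      - Y.2 j * (1 / Complex.I) * fderiv ℝ φ ξ (Pi.single j 1)) := by
  simp only [Omega, sum_apply]
  refine Finset.sum_congr rfl fun j _ => ?_
  simp only [sub_apply, smul_apply, smul_eq_mul, coordOp, partialOp]
  rw [SchwartzMap.smulLeftCLM_apply_apply (coord_temperate j)]
  rfl

/-- The unitary group `e^{iΩ(X)}` for real `X = (P, Q)`:
`(e^{iΩ(X)} φ)(ξ) = e^{i P·ξ - (i/2) P·Q} φ(ξ - Q)`. -/
def weyl {n : ℕ} (X : Phase ℝ n) (φ : (Fin n → ℝ) → ℂ) : (Fin n → ℝ) → ℂ := fun ξ =>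
  Complex.exp (Complex.I * ((∑ j, X.1 j * ξ j - (∑ j, X.1 j * X.2 j) / 2 : ℝ) : ℂ)) * φ (ξ - X.2)

/-- `e^{iΩ(X)} e^{iΩ(X')} = e^{iΩ(X + X')} e^{(i/2) ω(X, X')}`. -/
theorem weyl_weyl {n : ℕ} (X X' : Phase ℝ n) (φ : (Fin n → ℝ) → ℂ) (ξ : Fin n → ℝ) :
    weyl X (weyl X' φ) ξ
      = Complex.exp (Complex.I / 2 * ((omega X X' : ℝ) : ℂ)) * weyl (X + X') φ ξ := by
  simp only [weyl, omega]
  rw [← mul_assoc, ← mul_assoc, ← Complex.exp_add, ← Complex.exp_add]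
  congr 2
  · push_cast
    simp only [Prod.fst_add, Prod.snd_add, Pi.add_apply, Pi.sub_apply, Complex.ofReal_add,
      Complex.ofReal_sub, add_mul, mul_add, mul_sub, Finset.sum_add_distrib,
      Finset.sum_sub_distrib]
    ring
  · simp only [Prod.snd_add]
    abel

/-- The generator of `t ↦ e^{itΩ(X)}` is `iΩ(X)`. -/
theorem weyl_hasDerivAt {n : ℕ} (X : Phase ℝ n) (φ : 𝓢(Fin n → ℝ, ℂ)) (ξ : Fin n → ℝ) :
    HasDerivAt (fun t : ℝ => weyl (t • X) φ ξ) (Complex.I * Omega X.toComplex φ ξ) 0 := by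
  have h1 : HasDerivAt (fun t : ℝ =>
      t * ∑ j, X.1 j * ξ j - t ^ 2 * ((∑ j, X.1 j * X.2 j) / 2)) (∑ j, X.1 j * ξ j) 0 := by
    have := ((hasDerivAt_id (0 : ℝ)).mul_const (∑ j, X.1 j * ξ j)).sub
      ((hasDerivAt_pow 2 (0 : ℝ)).mul_const ((∑ j, X.1 j * X.2 j) / 2))
    refine this.congr_deriv ?_
    simp
  have h2 := (h1.ofReal_comp.const_mul Complex.I).cexp
  have h3 : HasDerivAt (fun t : ℝ => ξ - t • X.2) (-X.2) 0 := by
    simpa using ((hasDerivAt_id (0 : ℝ)).smul_const X.2).const_sub ξ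
  have h4 : HasDerivAt (fun t : ℝ => φ (ξ - t • X.2)) (fderiv ℝ φ ξ (-X.2)) 0 := by
    have hφ : HasFDerivAt φ (fderiv ℝ φ ξ) (ξ - (0 : ℝ) • X.2) := by
      simpa using φ.hasFDerivAt ξ
    exact hφ.comp_hasDerivAt (0 : ℝ) h3
  have h5 : fderiv ℝ φ ξ X.2 = ∑ j, (X.2 j : ℂ) * fderiv ℝ φ ξ (Pi.single j 1) := by
    conv_lhs => rw [pi_eq_sum_univ' X.2]
    simp [map_sum, Pi.single]
  have h6 : (fun t : ℝ => weyl (t • X) φ ξ) = fun t : ℝ => Complex.exp (Complex.I *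
      ((t * ∑ j, X.1 j * ξ j - t ^ 2 * ((∑ j, X.1 j * X.2 j) / 2) : ℝ) : ℂ)) * φ (ξ - t • X.2) := by
    funext t
    simp only [weyl, Prod.smul_fst, Prod.smul_snd, Pi.smul_apply, smul_eq_mul]
    congr 5
    · rw [Finset.mul_sum]
      exact Finset.sum_congr rfl fun j _ => by ring
    · rw [Finset.sum_div, Finset.sum_div, Finset.mul_sum]
      exact Finset.sum_congr rfl fun j _ => by ring
  rw [h6]
  refine (h2.mul h4).congr_deriv ?_
  rw [Omega_apply, map_neg, h5]
  simp only [Phase.toComplex, Finset.mul_sum, zero_mul,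
    ne_eq, OfNat.ofNat_ne_zero, not_false_eq_true, zero_pow, Complex.ofReal_zero,
    mul_zero, Complex.exp_zero, one_mul, zero_smul, Complex.ofReal_sum, Complex.ofReal_mul,
    Finset.sum_mul, sub_eq_add_neg, ← Finset.sum_neg_distrib, neg_zero, add_zero,
    Finset.sum_const_zero]
  rw [← Finset.sum_add_distrib]
  refine Finset.sum_congr rfl fun j _ => ?_
  have hI := Complex.I_ne_zero
  field_simp

/-- The inner product `(f, g) = ∫ f̄ g dξ`. -/
def l2Inner {n : ℕ} (f g : (Fin n → ℝ) → ℂ) : ℂ := ∫ ξ, conj (f ξ) * g ξ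

/-- The inner product of the constrained system, `⟨f, g⟩ = ∫_L (f, e^{iΩ(X)} g) dμ(X)`. -/
def physInner {n : ℕ} (L : Submodule ℝ (Phase ℝ n)) (μ : Measure L)
    (f g : 𝓢(Fin n → ℝ, ℂ)) : ℂ :=
  ∫ X : L, l2Inner f (weyl (X : Phase ℝ n) g) ∂μ

/-- `f ∼ 0`: the vector has zero norm, `⟨f, f⟩ = 0`. -/
def IsNull {n : ℕ} (L : Submodule ℝ (Phase ℝ n)) (μ : Measure L) (f : 𝓢(Fin n → ℝ, ℂ)) : Prop :=
  physInner L μ f f = 0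

/-- `f ∼ g`: the two wave functions give the same vector of the constrained Hilbert space. -/
def PhysEquiv {n : ℕ} (L : Submodule ℝ (Phase ℝ n)) (μ : Measure L)
    (f g : 𝓢(Fin n → ℝ, ℂ)) : Prop :=
  IsNull L μ (f - g)

/-- The quadratic form `∑_{jk} ξⱼ A_{jk} ξ_k`. -/
def quad {n : ℕ} (A : Matrix (Fin n) (Fin n) ℂ) (ξ : Fin n → ℝ) : ℂ :=
  ∑ j, ∑ k, (ξ j : ℂ) * A j k * (ξ k : ℂ)

/-- The condition on `A` under which `exp((i/2) ∑ ξⱼ A_{jk} ξ_k)` is a Schwartz function: its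
imaginary part is a positive definite quadratic form. -/
def ImPos {n : ℕ} (A : Matrix (Fin n) (Fin n) ℂ) : Prop :=
  ∀ ξ : Fin n → ℝ, ξ ≠ 0 → 0 < (quad A ξ).im

/-- The exponent `(i/2) ∑ ξⱼ A_{jk} ξ_k`. -/
def gaussExponent {n : ℕ} (A : Matrix (Fin n) (Fin n) ℂ) (ξ : Fin n → ℝ) : ℂ :=
  Complex.I / 2 * quad A ξ

theorem gaussExponent_temperate {n : ℕ} (A : Matrix (Fin n) (Fin n) ℂ) :
    (gaussExponent A).HasTemperateGrowth := by
  unfold gaussExponent quad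
  refine (Function.HasTemperateGrowth.const _).mul ?_
  refine Function.HasTemperateGrowth.sum fun j _ => Function.HasTemperateGrowth.sum fun k _ => ?_
  exact ((coord_temperate j).mul (Function.HasTemperateGrowth.const _)).mul (coord_temperate k)

theorem quad_smul {n : ℕ} (A : Matrix (Fin n) (Fin n) ℂ) (r : ℝ) (ξ : Fin n → ℝ) :
    quad A (r • ξ) = (r : ℂ) ^ 2 * quad A ξ := by
  simp only [quad, Finset.mul_sum, Pi.smul_apply, smul_eq_mul, Complex.ofReal_mul]
  refine Finset.sum_congr rfl fun j _ => Finset.sum_congr rfl fun k _ => by ring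

theorem gaussExponent_re_le {n : ℕ} {A : Matrix (Fin n) (Fin n) ℂ} (hA : ImPos A) :
    ∃ ε > 0, ∀ ξ, (gaussExponent A ξ).re ≤ -ε * ‖ξ‖ ^ 2 := by
  have hre : ∀ ξ, (gaussExponent A ξ).re = -(quad A ξ).im / 2 := fun ξ => by
    simp [gaussExponent, Complex.mul_re]
    ring
  have hq0 : quad A 0 = 0 := by simp [quad]
  rcases (Metric.sphere (0 : Fin n → ℝ) 1).eq_empty_or_nonempty with he | hne
  · refine ⟨1, one_pos, fun ξ => ?_⟩
    have : ξ = 0 := by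
      by_contra h
      have : ‖ξ‖⁻¹ • ξ ∈ Metric.sphere (0 : Fin n → ℝ) 1 := by
        simp [norm_smul, norm_ne_zero_iff.2 h]
      simp [he] at this
    simp [this, hre, hq0]
  · have hc : Continuous fun ξ => (quad A ξ).im := by
      unfold quad
      fun_prop
    obtain ⟨x, hx, hmin⟩ := (isCompact_sphere (0 : Fin n → ℝ) 1).exists_isMinOn hne hc.continuousOn
    have hx0 : x ≠ 0 := by
      rintro rfl
      simp at hx
    refine ⟨(quad A x).im / 2, half_pos (hA x hx0), fun ξ => ?_⟩
    by_cases h : ξ = 0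
    · simp [h, hre, hq0]
    have hn := norm_ne_zero_iff.2 h
    have hs : ‖ξ‖⁻¹ • ξ ∈ Metric.sphere (0 : Fin n → ℝ) 1 := by simp [norm_smul, hn]
    have h1 : (quad A x).im ≤ (quad A (‖ξ‖⁻¹ • ξ)).im := hmin hs
    have h2 : (quad A ξ).im = ‖ξ‖ ^ 2 * (quad A (‖ξ‖⁻¹ • ξ)).im := by
      conv_lhs => rw [← one_smul ℝ ξ, ← mul_inv_cancel₀ hn, ← smul_smul, quad_smul]
      rw [← Complex.ofReal_pow, Complex.im_ofReal_mul]
    rw [hre, h2]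
    nlinarith [mul_le_mul_of_nonneg_left h1 (sq_nonneg ‖ξ‖)]

theorem norm_iteratedFDeriv_cexp (i : ℕ) (z : ℂ) :
    ‖iteratedFDeriv ℝ i Complex.exp z‖
      = ‖Complex.exp z‖ * ‖iteratedFDeriv ℝ i Complex.exp 0‖ := by
  have h : Complex.exp = fun w => Complex.exp z • Complex.exp (w - z) := by
    funext w
    rw [smul_eq_mul, ← Complex.exp_add]
    congr 1
    ring
  have hc : ContDiff ℝ i fun w : ℂ => Complex.exp (w - z) := by fun_prop
  conv_lhs => rw [h]
  rw [iteratedFDeriv_const_smul_apply' hc.contDiffAt, norm_smul, iteratedFDeriv_comp_sub, sub_self]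

theorem one_add_pow_mul_exp_le (N : ℕ) {ε r : ℝ} (hε : 0 < ε) (hr : 0 ≤ r) :
    (1 + r) ^ N * Real.exp (-ε * r ^ 2) ≤ N.factorial * Real.exp (1 + 1 / (4 * ε)) := by
  have h1 : (1 + r) ^ N ≤ N.factorial * Real.exp (1 + r) := by
    have := Real.pow_div_factorial_le_exp (1 + r) (by positivity) N
    rwa [div_le_iff₀ (by positivity), mul_comm] at this
  have h2 : 1 + r + -ε * r ^ 2 ≤ 1 + 1 / (4 * ε) := by
    have : 1 / (4 * ε) - r + ε * r ^ 2 = (2 * ε * r - 1) ^ 2 / (4 * ε) := by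
      field_simp
      ring
    have h3 : 0 ≤ (2 * ε * r - 1) ^ 2 / (4 * ε) := by positivity
    linarith
  calc (1 + r) ^ N * Real.exp (-ε * r ^ 2)
      ≤ N.factorial * Real.exp (1 + r) * Real.exp (-ε * r ^ 2) := by gcongr
    _ = N.factorial * Real.exp (1 + r + -ε * r ^ 2) := by rw [mul_assoc, ← Real.exp_add]
    _ ≤ _ := by gcongr

theorem gauss_decay {n : ℕ} {A : Matrix (Fin n) (Fin n) ℂ} (hA : ImPos A) (k m : ℕ) :
    ∃ C : ℝ, ∀ ξ, ‖ξ‖ ^ k *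
      ‖iteratedFDeriv ℝ m (fun ξ => Complex.exp (gaussExponent A ξ)) ξ‖ ≤ C := by
  obtain ⟨ε, hε, hre⟩ := gaussExponent_re_le hA
  obtain ⟨l, D, hD0, hD⟩ := (gaussExponent_temperate A).norm_iteratedFDeriv_le_uniform m
  set K : ℝ := ∑ i ∈ Finset.range (m + 1), ‖iteratedFDeriv ℝ i Complex.exp 0‖ with hK
  refine ⟨m.factorial * K * (1 + D) ^ m *
    ((k + l * m).factorial * Real.exp (1 + 1 / (4 * ε))), fun ξ => ?_⟩
  have hK0 : 0 ≤ K := Finset.sum_nonneg fun _ _ => norm_nonneg _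
  have h1 : (1 : ℝ) ≤ (1 + ‖ξ‖) ^ l := one_le_pow₀ (by linarith [norm_nonneg ξ])
  have hmain := norm_iteratedFDeriv_comp_le (𝕜 := ℝ) (g := Complex.exp) (f := gaussExponent A)
    (n := m) (N := m) (by fun_prop)
    ((gaussExponent_temperate A).1.of_le (by exact_mod_cast le_top)) le_rfl ξ
    (C := K * Real.exp (-ε * ‖ξ‖ ^ 2)) (D := (1 + D) * (1 + ‖ξ‖) ^ l)
    (fun i hi => by
      rw [norm_iteratedFDeriv_cexp, mul_comm]
      refine mul_le_mul ?_ ?_ (norm_nonneg _) hK0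
      · exact Finset.single_le_sum (f := fun i => ‖iteratedFDeriv ℝ i Complex.exp (0 : ℂ)‖)
          (fun _ _ => norm_nonneg _) (Finset.mem_range.2 (by omega))
      · rw [Complex.norm_exp]
        exact Real.exp_le_exp.2 (hre ξ))
    (fun i hi him => by
      refine (hD i him ξ).trans ?_
      have h2 : D * (1 + ‖ξ‖) ^ l ≤ (1 + D) * (1 + ‖ξ‖) ^ l := by
        gcongr
        linarith
      refine h2.trans (le_self_pow₀ ?_ (by omega))
      nlinarith)
  have hexp := one_add_pow_mul_exp_le (k + l * m) hε (norm_nonneg ξ)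
  calc ‖ξ‖ ^ k * ‖iteratedFDeriv ℝ m (fun ξ => Complex.exp (gaussExponent A ξ)) ξ‖
      ≤ (1 + ‖ξ‖) ^ k * (m.factorial * (K * Real.exp (-ε * ‖ξ‖ ^ 2)) *
          ((1 + D) * (1 + ‖ξ‖) ^ l) ^ m) := by
        refine mul_le_mul ?_ hmain (norm_nonneg _) (by positivity)
        gcongr
        linarith
    _ = m.factorial * K * (1 + D) ^ m *
          ((1 + ‖ξ‖) ^ (k + l * m) * Real.exp (-ε * ‖ξ‖ ^ 2)) := by
        rw [mul_pow, ← pow_mul, pow_add]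
        ring
    _ ≤ _ := by gcongr

/-- The Gaussian wave function `ψ_A(ξ) = exp((i/2) ∑ ξⱼ A_{jk} ξ_k)` as a Schwartz function. -/
def gaussian {n : ℕ} (A : Matrix (Fin n) (Fin n) ℂ) (hA : ImPos A) : 𝓢(Fin n → ℝ, ℂ) where
  toFun ξ := Complex.exp (Complex.I / 2 * ∑ j, ∑ k, (ξ j : ℂ) * A j k * (ξ k : ℂ))
  smooth' := Complex.contDiff_exp.comp (gaussExponent_temperate A).1
  decay' k m := gauss_decay hA k m

/-- The H-germ of `ψ_A`: all complex `Y` that are skew-orthogonal to `L`, so that `Ω(Y)` is an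
operator of the constrained theory, with `‖Ω(Y) ψ_A‖ = 0`. By linearity,
skew-orthogonality to `L` is the same as skew-orthogonality to its complexification. -/
def hGerm {n : ℕ} (L : Submodule ℝ (Phase ℝ n)) (μ : Measure L)
    (A : Matrix (Fin n) (Fin n) ℂ) (hA : ImPos A) : Set (Phase ℂ n) :=
  {Y | (∀ X ∈ L, omega Y X.toComplex = 0) ∧ IsNull L μ (Omega Y (gaussian A hA))}

end Constrained

end

open MeasureTheory SchwartzMap
open scoped ComplexConjugate

noncomputable section

namespace Constrained

variable {n : ℕ}

/-! ### The Weyl operators on Schwartz space -/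

/-! Write W(X) for e^{iΩ(X)} and ψ for `gaussian A hA`. The constrained product is an average of W
over L. Since L is isotropic, these operators form a commuting unitary group, so the average behaves
like a projection: it is positive semidefinite, and Cauchy–Schwarz makes the null vectors a
subspace, namely the radical of the form. If Y is skew to L, Ω(Y) commutes with the averaged
operators, has adjoint Ω(Ȳ) and preserves null vectors. Gaussians are never null, because (ψ, W(X)ψ)
> 0 for every X. Hence equivalence up to a scalar, which must be nonzero, makes Ω(Y)ψ null for both
Gaussians or for neither, and the germs agree.

For the converse, let f be the first Gaussian minus its projection onto the second, ψ. The common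
germ of the two Gaussians annihilates f modulo null vectors, and f is orthogonal to ψ. To see that f
is null, consider h(t) = ⟨W(tZ)ψ, f⟩ for real Z. Its derivative contains Ω(Z)ψ, which equals Ω(Ȳ)ψ
for some Y in the germ. Moving Ω(Ȳ) past W(tZ) costs a scalar multiple of t, and its adjoint Ω(Y)
kills f, so h' = tκh with h(0) = 0, and h vanishes. Thus f is orthogonal to every coherent state
W(Z)ψ, and these resolve the identity (`integral_conj_mul_l2Inner_weylOp`), so ⟨f, f⟩ = 0.

The existence of Y is linear algebra (`conjSymbolMap_surjective`). Acting on ψ, the operator Ω(Y)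
multiplies it by the linear form P − AQ. The germ contains the complexification of L and the part of
the Lagrangian plane P = AQ skew to L. Positivity of Im A makes Y ↦ symbol of Ȳ injective on their
direct sum, whose dimension is n, so every symbol is reached. -/

theorem iteratedDeriv_cexp_I_mul (k : ℕ) :
    iteratedDeriv k (fun t : ℝ => Complex.exp (Complex.I * t))
      = fun t : ℝ => Complex.I ^ k * Complex.exp (Complex.I * t) := by
  induction k with
  | zero => simp
  | succ k ih =>
    rw [iteratedDeriv_succ, ih]
    funext t
    have h : HasDerivAt (fun t : ℝ => Complex.I ^ k * Complex.exp (Complex.I * t))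
        (Complex.I ^ k * (Complex.exp (Complex.I * t) * (Complex.I * 1))) t :=
      ((((hasDerivAt_id t).ofReal_comp).const_mul Complex.I).cexp).const_mul _
    rw [h.deriv]
    ring

theorem cexp_I_mul_temperate :
    Function.HasTemperateGrowth (fun t : ℝ => Complex.exp (Complex.I * t)) := by
  refine ⟨Complex.contDiff_exp.comp (contDiff_const.mul Complex.ofRealCLM.contDiff), fun k => ⟨0, 1, fun t => ?_⟩⟩
  rw [norm_iteratedFDeriv_eq_norm_iteratedDeriv, iteratedDeriv_cexp_I_mul]
  simp [mul_comm Complex.I, Complex.norm_exp_ofReal_mul_I]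

/-- The phase factor of the Weyl operator. -/
def weylPhase (X : Phase ℝ n) (ξ : Fin n → ℝ) : ℂ :=
  Complex.exp (Complex.I * ((∑ j, X.1 j * ξ j - (∑ j, X.1 j * X.2 j) / 2 : ℝ) : ℂ))

theorem weylPhase_temperate (X : Phase ℝ n) : (weylPhase X).HasTemperateGrowth := by
  have h : Function.HasTemperateGrowth
      (fun ξ : Fin n → ℝ => ∑ j, X.1 j * ξ j - (∑ j, X.1 j * X.2 j) / 2) := by
    refine Function.HasTemperateGrowth.sub ?_ (Function.HasTemperateGrowth.const _)
    refine Function.HasTemperateGrowth.sum fun j _ => ?_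
    exact (Function.HasTemperateGrowth.const _).mul
      (ContinuousLinearMap.proj (R := ℝ) (φ := fun _ : Fin n => ℝ) j).hasTemperateGrowth
  exact cexp_I_mul_temperate.comp h

theorem norm_weylPhase (X : Phase ℝ n) (ξ : Fin n → ℝ) : ‖weylPhase X ξ‖ = 1 := by
  rw [weylPhase, mul_comm, Complex.norm_exp_ofReal_mul_I]

/-- The Weyl operator `e^{iΩ(X)}` as a continuous operator on Schwartz space. -/
def weylOp (X : Phase ℝ n) : 𝓢(Fin n → ℝ, ℂ) →L[ℂ] 𝓢(Fin n → ℝ, ℂ) :=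
  SchwartzMap.smulLeftCLM ℂ (weylPhase X) ∘L SchwartzMap.compSubConstCLM ℂ X.2

theorem weylOp_apply (X : Phase ℝ n) (f : 𝓢(Fin n → ℝ, ℂ)) (ξ : Fin n → ℝ) :
    weylOp X f ξ = weylPhase X ξ * f (ξ - X.2) := by
  simp [weylOp, SchwartzMap.smulLeftCLM_apply_apply (weylPhase_temperate X)]

theorem weyl_eq_weylOp (X : Phase ℝ n) (f : 𝓢(Fin n → ℝ, ℂ)) : weyl X f = weylOp X f := by
  funext ξ
  rw [weylOp_apply]
  rfl

theorem norm_weylOp_apply (X : Phase ℝ n) (f : 𝓢(Fin n → ℝ, ℂ)) (ξ : Fin n → ℝ) :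
    ‖weylOp X f ξ‖ = ‖f (ξ - X.2)‖ := by
  rw [weylOp_apply, norm_mul, norm_weylPhase, one_mul]

theorem weylOp_zero (f : 𝓢(Fin n → ℝ, ℂ)) : weylOp 0 f = f := by
  ext ξ
  simp [weylOp_apply, weylPhase]

theorem weylOp_weylOp (X X' : Phase ℝ n) (f : 𝓢(Fin n → ℝ, ℂ)) :
    weylOp X (weylOp X' f)
      = Complex.exp (Complex.I / 2 * ((omega X X' : ℝ) : ℂ)) • weylOp (X + X') f := by
  ext ξ
  have := weyl_weyl X X' f ξ
  rwa [weyl_eq_weylOp, weyl_eq_weylOp, weyl_eq_weylOp] at this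

theorem norm_cexp_I_half_mul (r : ℝ) : ‖Complex.exp (Complex.I / 2 * (r : ℂ))‖ = 1 := by
  have : Complex.I / 2 * (r : ℂ) = ((r / 2 : ℝ) : ℂ) * Complex.I := by
    push_cast
    ring
  rw [this, Complex.norm_exp_ofReal_mul_I]

theorem continuous_weylOp_apply (f : 𝓢(Fin n → ℝ, ℂ)) :
    Continuous fun p : Phase ℝ n × (Fin n → ℝ) => weylOp p.1 f p.2 := by
  simp only [weylOp_apply, weylPhase]
  have := f.continuous
  fun_prop

/-! ### The symplectic form -/

theorem omega_add_left {R : Type} [CommRing R] (X X' Z : Phase R n) :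
    omega (X + X') Z = omega X Z + omega X' Z := by
  simp only [omega, Prod.fst_add, Prod.snd_add, Pi.add_apply, ← Finset.sum_add_distrib]
  exact Finset.sum_congr rfl fun j _ => by ring

theorem omega_swap {R : Type} [CommRing R] (X X' : Phase R n) : omega X X' = -omega X' X := by
  simp only [omega, ← Finset.sum_neg_distrib]
  exact Finset.sum_congr rfl fun j _ => by ring

theorem omega_add_right {R : Type} [CommRing R] (X Z Z' : Phase R n) :
    omega X (Z + Z') = omega X Z + omega X Z' := by
  rw [omega_swap, omega_add_left, omega_swap Z, omega_swap Z']
  ring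

theorem omega_smul_left {R : Type} [CommRing R] (c : R) (X X' : Phase R n) :
    omega (c • X) X' = c * omega X X' := by
  simp only [omega, Prod.smul_fst, Prod.smul_snd, Pi.smul_apply, smul_eq_mul, Finset.mul_sum]
  exact Finset.sum_congr rfl fun j _ => by ring

theorem omega_smul_right {R : Type} [CommRing R] (c : R) (X X' : Phase R n) :
    omega X (c • X') = c * omega X X' := by
  rw [omega_swap, omega_smul_left, omega_swap X']
  ring

theorem omega_neg_left {R : Type} [CommRing R] (X X' : Phase R n) :
    omega (-X) X' = -omega X X' := by
  rw [← neg_one_smul R X, omega_smul_left]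
  ring

theorem omega_self (X : Phase ℝ n) : omega X X = 0 := by
  have := omega_swap X X
  linarith

/-- Complex conjugation on the complexified phase space. -/
def Phase.conj (Y : Phase ℂ n) : Phase ℂ n :=
  (fun j => starRingEnd ℂ (Y.1 j), fun j => starRingEnd ℂ (Y.2 j))

theorem Phase.conj_conj (Y : Phase ℂ n) : Y.conj.conj = Y := by
  simp [Phase.conj]

theorem Phase.conj_toComplex (X : Phase ℝ n) : X.toComplex.conj = X.toComplex := by
  simp [Phase.conj, Phase.toComplex]

theorem omega_conj (Y Z : Phase ℂ n) : omega Y.conj Z.conj = starRingEnd ℂ (omega Y Z) := by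
  simp [omega, Phase.conj]

/-! ### The operators `Ω(Y)` -/

theorem Omega_add (Y Z : Phase ℂ n) : Omega (Y + Z) = Omega Y + Omega Z := by
  simp only [Omega, Prod.fst_add, Prod.snd_add, Pi.add_apply, ← Finset.sum_add_distrib]
  refine Finset.sum_congr rfl fun j _ => ?_
  rw [add_smul, add_mul, add_smul]
  abel

theorem Omega_smul (c : ℂ) (Y : Phase ℂ n) : Omega (c • Y) = c • Omega Y := by
  simp only [Omega, Prod.smul_fst, Prod.smul_snd, Pi.smul_apply, Finset.smul_sum, smul_sub,
    smul_smul, smul_eq_mul, mul_assoc]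

theorem hasLineDerivAt_weylPhase (X : Phase ℝ n) (ξ v : Fin n → ℝ) :
    HasLineDerivAt ℝ (weylPhase X)
      (weylPhase X ξ * (Complex.I * ((∑ j, X.1 j * v j : ℝ) : ℂ))) ξ v := by
  unfold HasLineDerivAt weylPhase
  have h : HasDerivAt (fun t : ℝ => ∑ j, X.1 j * (ξ + t • v) j - (∑ j, X.1 j * X.2 j) / 2)
      (∑ j, X.1 j * v j) 0 := by
    refine HasDerivAt.sub_const _ ?_
    refine HasDerivAt.fun_sum fun j _ => ?_
    simpa using ((((hasDerivAt_id (0 : ℝ)).mul_const (v j)).const_add (ξ j)).const_mul (X.1 j))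
  have := (h.ofReal_comp.const_mul Complex.I).cexp
  simpa using this

theorem fderiv_weylOp (X : Phase ℝ n) (f : 𝓢(Fin n → ℝ, ℂ)) (ξ v : Fin n → ℝ) :
    fderiv ℝ (weylOp X f) ξ v = weylPhase X ξ * (fderiv ℝ f (ξ - X.2) v
      + Complex.I * ((∑ j, X.1 j * v j : ℝ) : ℂ) * f (ξ - X.2)) := by
  have h1 : HasLineDerivAt ℝ (fun ξ => f (ξ - X.2)) (fderiv ℝ f (ξ - X.2) v) ξ v := by
    have : HasFDerivAt (fun ξ => f (ξ - X.2)) ((fderiv ℝ f (ξ - X.2)).comp (.id ℝ _)) ξ :=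
      (f.hasFDerivAt (ξ - X.2)).comp ξ ((hasFDerivAt_id ξ).sub_const X.2)
    exact this.hasLineDerivAt v
  have h2 : HasDerivAt (fun t : ℝ => weylPhase X (ξ + t • v) * f (ξ + t • v - X.2)) _ 0 :=
    HasDerivAt.mul (hasLineDerivAt_weylPhase X ξ v) h1
  have h3 : HasDerivAt (fun t : ℝ => weylPhase X (ξ + t • v) * f (ξ + t • v - X.2))
      (fderiv ℝ (weylOp X f) ξ v) 0 := by
    have := ((weylOp X f).hasFDerivAt ξ).hasLineDerivAt v
    exact this.congr_of_eventuallyEq (.of_forall fun t => (weylOp_apply X f _).symm)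
  rw [h3.unique h2]
  simp
  ring

/-- This is the canonical commutation relation in exponentiated form: conjugation by a Weyl operator
shifts Ω(Y) by a scalar. Skew-orthogonality to L is exactly the vanishing of that scalar on L. -/
theorem Omega_weylOp (Y : Phase ℂ n) (X : Phase ℝ n) (f : 𝓢(Fin n → ℝ, ℂ)) :
    Omega Y (weylOp X f) = weylOp X (Omega Y f) + omega Y X.toComplex • weylOp X f := by
  ext ξ
  simp only [add_apply, smul_apply, smul_eq_mul, Omega_apply, weylOp_apply,
    fderiv_weylOp, omega, Phase.toComplex, Finset.mul_sum, Finset.sum_mul]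
  rw [← Finset.sum_add_distrib]
  refine Finset.sum_congr rfl fun j _ => ?_
  have : (∑ i, (X.1 i : ℂ) * ((Pi.single j (1 : ℝ) : Fin n → ℝ) i : ℂ)) = X.1 j := by
    rw [Finset.sum_eq_single j] <;> simp +contextual
  have hI := Complex.I_ne_zero
  push_cast
  rw [this, Pi.sub_apply]
  push_cast
  field_simp
  ring

/-! ### The `L²` pairing -/

/-- Complex conjugation on Schwartz functions. -/
def conjSchwartz (f : 𝓢(Fin n → ℝ, ℂ)) : 𝓢(Fin n → ℝ, ℂ) :=
  SchwartzMap.postcompCLM (𝕜 := ℝ) Complex.conjCLE.toContinuousLinearMap f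

theorem conjSchwartz_apply (f : 𝓢(Fin n → ℝ, ℂ)) (ξ : Fin n → ℝ) :
    conjSchwartz f ξ = conj (f ξ) := rfl

theorem integrable_conj_mul (f g : 𝓢(Fin n → ℝ, ℂ)) :
    Integrable fun ξ => conj (f ξ) * g ξ :=
  (SchwartzMap.pairing (ContinuousLinearMap.mul ℝ ℂ) (conjSchwartz f) g).integrable

theorem l2Inner_add_right (f g h : 𝓢(Fin n → ℝ, ℂ)) :
    l2Inner f (g + h : 𝓢(Fin n → ℝ, ℂ)) = l2Inner f g + l2Inner f h := by
  simp only [l2Inner, add_apply, mul_add]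
  exact integral_add (integrable_conj_mul f g) (integrable_conj_mul f h)

theorem l2Inner_smul_right (c : ℂ) (f g : 𝓢(Fin n → ℝ, ℂ)) :
    l2Inner f (c • g : 𝓢(Fin n → ℝ, ℂ)) = c * l2Inner f g := by
  simp only [l2Inner, smul_apply, smul_eq_mul, ← integral_const_mul]
  exact integral_congr_ae (.of_forall fun ξ => by ring)

theorem l2Inner_conj_symm (f g : (Fin n → ℝ) → ℂ) : conj (l2Inner g f) = l2Inner f g := by
  simp only [l2Inner, ← integral_conj, map_mul, Complex.conj_conj]
  exact integral_congr_ae (.of_forall fun ξ => by ring)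

theorem l2Inner_weylOp_left (X : Phase ℝ n) (f g : 𝓢(Fin n → ℝ, ℂ)) :
    l2Inner (weylOp X f) g = l2Inner f (weylOp (-X) g) := by
  simp only [l2Inner]
  rw [← integral_sub_right_eq_self (fun ξ => conj (f ξ) * weylOp (-X) g ξ) X.2]
  refine integral_congr_ae (.of_forall fun ξ => ?_)
  simp only [weylOp_apply, weylPhase, map_mul, ← Complex.exp_conj, Complex.conj_I,
    Complex.conj_ofReal]
  simp only [Prod.fst_neg, Prod.snd_neg, Pi.neg_apply, Pi.sub_apply, sub_neg_eq_add,
    sub_add_cancel]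
  have h : -Complex.I * ((∑ j, X.1 j * ξ j - (∑ j, X.1 j * X.2 j) / 2 : ℝ) : ℂ)
      = Complex.I * ((∑ j, -X.1 j * (ξ j - X.2 j) - (∑ j, -X.1 j * -X.2 j) / 2 : ℝ) : ℂ) := by
    rw [neg_mul, ← mul_neg, ← Complex.ofReal_neg]
    congr 2
    simp only [mul_sub, neg_mul, mul_neg, neg_neg, Finset.sum_sub_distrib, Finset.sum_neg_distrib]
    ring
  rw [h]
  ring

theorem l2Inner_weylOp_weylOp (X X' : Phase ℝ n) (f g : 𝓢(Fin n → ℝ, ℂ)) :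
    l2Inner (weylOp X f) (weylOp X' g)
      = Complex.exp (Complex.I / 2 * ((-omega X X' : ℝ) : ℂ)) * l2Inner f (weylOp (X' - X) g) := by
  rw [l2Inner_weylOp_left, weylOp_weylOp, l2Inner_smul_right, omega_neg_left, neg_add_eq_sub]

theorem l2Inner_partialOp (j : Fin n) (f g : 𝓢(Fin n → ℝ, ℂ)) :
    l2Inner (partialOp j f) g = -l2Inner f (partialOp j g) := by
  have h := SchwartzMap.integral_mul_lineDerivOp_right_eq_neg_left (μ := volume)
    (conjSchwartz f) g (Pi.single j 1)
  have h2 : ∀ ξ, LineDeriv.lineDerivOp (Pi.single j (1 : ℝ) : Fin n → ℝ) (conjSchwartz f) ξ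
      = conj (partialOp j f ξ) := by
    intro ξ
    have : HasFDerivAt (conjSchwartz f)
        (Complex.conjCLE.toContinuousLinearMap.comp (fderiv ℝ f ξ)) ξ :=
      Complex.conjCLE.toContinuousLinearMap.hasFDerivAt.comp ξ (f.hasFDerivAt ξ)
    rw [SchwartzMap.lineDerivOp_apply_eq_fderiv, this.fderiv]
    rfl
  simp only [h2] at h
  rw [l2Inner, l2Inner]
  exact (neg_eq_iff_eq_neg.2 h).symm

theorem l2Inner_coordOp (j : Fin n) (f g : 𝓢(Fin n → ℝ, ℂ)) :
    l2Inner (coordOp j f) g = l2Inner f (coordOp j g) := by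
  simp only [l2Inner, coordOp, SchwartzMap.smulLeftCLM_apply_apply (coord_temperate j),
    smul_eq_mul, map_mul, Complex.conj_ofReal]
  exact integral_congr_ae (.of_forall fun ξ => by ring)

/-- The `L²` pairing as a linear function of the second argument. -/
def l2InnerHom (f : 𝓢(Fin n → ℝ, ℂ)) : 𝓢(Fin n → ℝ, ℂ) →ₗ[ℂ] ℂ where
  toFun g := l2Inner f g
  map_add' := l2Inner_add_right f
  map_smul' c g := l2Inner_smul_right c f g

/-- Coordinates and (1/i)∂ are symmetric on Schwartz functions, the latter by integration by parts,
so taking adjoints only conjugates the coefficients. -/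
theorem l2Inner_Omega_left (Y : Phase ℂ n) (f g : 𝓢(Fin n → ℝ, ℂ)) :
    l2Inner (Omega Y f) g = l2Inner f (Omega Y.conj g) := by
  rw [← l2Inner_conj_symm]
  change conj (l2InnerHom g (Omega Y f)) = l2InnerHom f (Omega Y.conj g)
  simp only [Omega, _root_.sum_apply, map_sum, _root_.sub_apply, _root_.smul_apply,
    map_sub, map_smul, smul_eq_mul, map_mul]
  refine Finset.sum_congr rfl fun j _ => ?_
  simp only [l2InnerHom, LinearMap.coe_mk, AddHom.coe_mk, l2Inner_conj_symm, l2Inner_coordOp,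
    l2Inner_partialOp, Phase.conj]
  simp

/-! ### Decay of matrix coefficients -/

theorem exists_norm_apply_le (f : 𝓢(Fin n → ℝ, ℂ)) : ∃ C, 0 ≤ C ∧ ∀ ξ, ‖f ξ‖ ≤ C :=
  ⟨SchwartzMap.seminorm ℝ 0 0 f, apply_nonneg _ _, fun ξ => norm_le_seminorm ℝ f ξ⟩

theorem exists_norm_l2Inner_weylOp_le (f g : 𝓢(Fin n → ℝ, ℂ)) :
    ∃ C, ∀ X, ‖l2Inner f (weylOp X g)‖ ≤ C := by
  obtain ⟨S, -, hS⟩ := exists_norm_apply_le g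
  refine ⟨∫ ξ, ‖f ξ‖ * S, fun X => ?_⟩
  refine norm_integral_le_of_norm_le (f.integrable.norm.mul_const S) (.of_forall fun ξ => ?_)
  rw [norm_mul, norm_weylOp_apply, RCLike.norm_conj]
  exact mul_le_mul_of_nonneg_left (hS _) (norm_nonneg _)

/-- The commutation relation trades a linear factor in X for changes of f and g within Schwartz
space; this is the source of all decay in X. -/
theorem omega_mul_l2Inner_weylOp (Y : Phase ℂ n) (X : Phase ℝ n) (f g : 𝓢(Fin n → ℝ, ℂ)) :
    omega Y X.toComplex * l2Inner f (weylOp X g)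
      = l2Inner (Omega Y.conj f) (weylOp X g) - l2Inner f (weylOp X (Omega Y g)) := by
  rw [l2Inner_Omega_left, Phase.conj_conj, Omega_weylOp, l2Inner_add_right, l2Inner_smul_right]
  ring

theorem norm_le_sum_coord (X : Phase ℝ n) : ‖X‖ ≤ ∑ j, (‖X.1 j‖ + ‖X.2 j‖) := by
  have h0 : ∀ j ∈ Finset.univ, 0 ≤ ‖X.1 j‖ + ‖X.2 j‖ := fun j _ => by positivity
  have h : ∀ j, ‖X.1 j‖ + ‖X.2 j‖ ≤ ∑ j, (‖X.1 j‖ + ‖X.2 j‖) := fun j =>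
    Finset.single_le_sum h0 (Finset.mem_univ j)
  refine norm_prod_le_iff.2 ⟨?_, ?_⟩ <;>
    refine (pi_norm_le_iff_of_nonneg (Finset.sum_nonneg h0)).2 fun j => le_trans ?_ (h j)
  · exact le_add_of_nonneg_right (norm_nonneg _)
  · exact le_add_of_nonneg_left (norm_nonneg _)

/-- Induction on N over all pairs of Schwartz functions: each coordinate of X is a pairing ω(Y, X)
with a basis vector Y, and such a factor is absorbed by `omega_mul_l2Inner_weylOp`. -/
theorem exists_pow_mul_norm_l2Inner_weylOp_le (N : ℕ) (f g : 𝓢(Fin n → ℝ, ℂ)) :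
    ∃ C, ∀ X, (1 + ‖X‖) ^ N * ‖l2Inner f (weylOp X g)‖ ≤ C := by
  induction N generalizing f g with
  | zero => simpa using exists_norm_l2Inner_weylOp_le f g
  | succ N ih =>
    have hY : ∀ Y : Phase ℂ n, ∃ C, ∀ X,
        (1 + ‖X‖) ^ N * (‖omega Y X.toComplex‖ * ‖l2Inner f (weylOp X g)‖) ≤ C := by
      intro Y
      obtain ⟨C₁, h₁⟩ := ih (Omega Y.conj f) g
      obtain ⟨C₂, h₂⟩ := ih f (Omega Y g)
      refine ⟨C₁ + C₂, fun X => ?_⟩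
      rw [← norm_mul, omega_mul_l2Inner_weylOp]
      refine le_trans ?_ (add_le_add (h₁ X) (h₂ X))
      rw [← mul_add]
      exact mul_le_mul_of_nonneg_left (norm_sub_le _ _) (by positivity)
    choose C hC using hY
    obtain ⟨C₀, h₀⟩ := ih f g
    refine ⟨C₀ + ∑ j, (C (0, Pi.single j 1) + C (Pi.single j 1, 0)), fun X => ?_⟩
    have hP : ∀ j, ‖omega (0, Pi.single j 1) X.toComplex‖ = ‖X.1 j‖ := fun j => by
      simp [omega, Phase.toComplex, Pi.single_apply]
    have hQ : ∀ j, ‖omega (Pi.single j 1, 0) X.toComplex‖ = ‖X.2 j‖ := fun j => by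
      simp [omega, Phase.toComplex, Pi.single_apply]
    set a := ‖l2Inner f (weylOp X g)‖ with ha
    have ha0 : 0 ≤ a := norm_nonneg _
    calc (1 + ‖X‖) ^ (N + 1) * a
        = (1 + ‖X‖) ^ N * a + (1 + ‖X‖) ^ N * a * ‖X‖ := by ring
      _ ≤ (1 + ‖X‖) ^ N * a + (1 + ‖X‖) ^ N * a * ∑ j, (‖X.1 j‖ + ‖X.2 j‖) := by
          gcongr
          exact norm_le_sum_coord X
      _ = (1 + ‖X‖) ^ N * a
          + ∑ j, ((1 + ‖X‖) ^ N * (‖X.1 j‖ * a) + (1 + ‖X‖) ^ N * (‖X.2 j‖ * a)) := by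
          rw [Finset.mul_sum]
          congr 1
          exact Finset.sum_congr rfl fun j _ => by ring
      _ ≤ _ := by
          refine add_le_add (h₀ X) (Finset.sum_le_sum fun j _ => add_le_add ?_ ?_)
          · rw [← hP]
            exact hC _ X
          · rw [← hQ]
            exact hC _ X

theorem exists_norm_l2Inner_weylOp_le_inv_pow (N : ℕ) (f g : 𝓢(Fin n → ℝ, ℂ)) :
    ∃ C, 0 ≤ C ∧ ∀ X, ‖l2Inner f (weylOp X g)‖ ≤ C * ((1 + ‖X‖) ^ N)⁻¹ := by
  obtain ⟨C, hC⟩ := exists_pow_mul_norm_l2Inner_weylOp_le N f g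
  refine ⟨C, le_trans (by positivity) (hC 0), fun X => ?_⟩
  rw [← div_eq_mul_inv, le_div_iff₀ (by positivity), mul_comm]
  exact hC X

theorem norm_l2Inner_weylOp_weylOp (Z X : Phase ℝ n) (f g : 𝓢(Fin n → ℝ, ℂ)) :
    ‖l2Inner (weylOp Z f) (weylOp X g)‖ = ‖l2Inner f (weylOp (X - Z) g)‖ := by
  rw [l2Inner_weylOp_weylOp, norm_mul, norm_cexp_I_half_mul, one_mul]

theorem one_add_norm_le_mul {V : Type*} [SeminormedAddCommGroup V] (X Z : V) :
    1 + ‖X‖ ≤ (1 + ‖X - Z‖) * (1 + ‖Z‖) := by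
  have h : ‖X‖ ≤ ‖X - Z‖ + ‖Z‖ := norm_le_norm_sub_add X Z
  nlinarith [mul_nonneg (norm_nonneg (X - Z)) (norm_nonneg Z)]

/-- Peetre's inequality: decay in X − Z gives decay in X at the cost of polynomial growth in Z. -/
theorem inv_one_add_norm_sub_pow_le {V : Type*} [SeminormedAddCommGroup V] (N : ℕ) (X Z : V) :
    ((1 + ‖X - Z‖) ^ N)⁻¹ ≤ (1 + ‖Z‖) ^ N * ((1 + ‖X‖) ^ N)⁻¹ := by
  rw [← div_eq_mul_inv, inv_eq_one_div, div_le_div_iff₀ (by positivity) (by positivity), one_mul,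
    ← mul_pow, mul_comm (1 + ‖Z‖)]
  exact pow_le_pow_left₀ (by positivity) (one_add_norm_le_mul X Z) N

theorem continuous_l2Inner_weylOp (f g : 𝓢(Fin n → ℝ, ℂ)) :
    Continuous fun X : Phase ℝ n => l2Inner f (weylOp X g) := by
  obtain ⟨S, -, hS⟩ := exists_norm_apply_le g
  refine continuous_of_dominated (bound := fun ξ => ‖f ξ‖ * S)
    (fun X => (integrable_conj_mul f (weylOp X g)).aestronglyMeasurable)
    (fun X => .of_forall fun ξ => ?_) (f.integrable.norm.mul_const S)
    (.of_forall fun ξ => ?_)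
  · rw [norm_mul, norm_weylOp_apply, RCLike.norm_conj]
    exact mul_le_mul_of_nonneg_left (hS _) (norm_nonneg _)
  · have h : Continuous fun X : Phase ℝ n => weylOp X g ξ :=
      (continuous_weylOp_apply g).comp₂ continuous_id continuous_const
    exact h.const_mul _

theorem continuous_l2Inner_weylOp_weylOp (f g : 𝓢(Fin n → ℝ, ℂ)) :
    Continuous fun p : Phase ℝ n × Phase ℝ n => l2Inner (weylOp p.1 f) (weylOp p.2 g) := by
  simp only [l2Inner_weylOp_weylOp]
  refine Continuous.mul ?_ ((continuous_l2Inner_weylOp f g).comp (by fun_prop :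
    Continuous fun p : Phase ℝ n × Phase ℝ n => p.2 - p.1))
  unfold omega
  fun_prop

theorem integrable_inv_one_add_norm_pow {V : Type*} [NormedAddCommGroup V] [NormedSpace ℝ V]
    [FiniteDimensional ℝ V] [MeasurableSpace V] [BorelSpace V] (μ : Measure V)
    [μ.IsAddHaarMeasure] {N : ℕ} (hN : Module.finrank ℝ V < N) :
    Integrable (fun x : V => ((1 + ‖x‖) ^ N)⁻¹) μ := by
  have := integrable_one_add_norm (μ := μ) (E := V) (r := N) (by exact_mod_cast hN)
  refine this.congr (.of_forall fun x => ?_)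
  simp only
  rw [Real.rpow_neg (by positivity), Real.rpow_natCast]

theorem finrank_phase : Module.finrank ℝ (Phase ℝ n) = n + n := by
  simp

/-- Makes the single exponent 2n + 1 sufficient for integrability on every L. -/
theorem finrank_submodule_lt (L : Submodule ℝ (Phase ℝ n)) :
    Module.finrank ℝ L < n + n + 1 := by
  have := Submodule.finrank_le L
  rw [finrank_phase] at this
  omega

/-! ### Derivatives along one-parameter groups -/

/-- Since ω(Z, Z) = 0, s ↦ W(sZ) is a one-parameter group, so the derivative at t is W(tZ) applied
to the derivative at 0. -/
theorem weylOp_smul_hasDerivAt (Z : Phase ℝ n) (g : 𝓢(Fin n → ℝ, ℂ)) (ξ : Fin n → ℝ) (t : ℝ) :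
    HasDerivAt (fun s : ℝ => weylOp (s • Z) g ξ)
      (weylOp (t • Z) (Complex.I • Omega Z.toComplex g) ξ) t := by
  have h0 := weyl_hasDerivAt Z g (ξ - (t • Z).2)
  have h1 : HasDerivAt (fun s : ℝ => weyl ((s - t) • Z) g (ξ - (t • Z).2))
      (Complex.I * Omega Z.toComplex g (ξ - (t • Z).2)) t := by
    rw [← sub_self t] at h0
    exact h0.comp_sub_const t t
  have h2 := h1.const_mul (weylPhase (t • Z) ξ)
  rw [weylOp_apply, smul_apply, smul_eq_mul]
  refine h2.congr_of_eventuallyEq (.of_forall fun s => ?_)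
  simp only [weyl_eq_weylOp]
  rw [← weylOp_apply, weylOp_weylOp, omega_smul_left, omega_smul_right, omega_self, ← add_smul]
  simp

theorem l2Inner_weylOp_smul_hasDerivAt (Z : Phase ℝ n) (g f : 𝓢(Fin n → ℝ, ℂ)) (t : ℝ) :
    HasDerivAt (fun s : ℝ => l2Inner (weylOp (s • Z) g) f)
      (l2Inner (weylOp (t • Z) (Complex.I • Omega Z.toComplex g)) f) t := by
  obtain ⟨S, -, hS⟩ := exists_norm_apply_le (Complex.I • Omega Z.toComplex g)
  refine (hasDerivAt_integral_of_dominated_loc_of_deriv_le (s := Set.univ)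
    (F := fun (s : ℝ) ξ => conj (weylOp (s • Z) g ξ) * f ξ)
    (F' := fun (s : ℝ) ξ => conj (weylOp (s • Z) (Complex.I • Omega Z.toComplex g) ξ) * f ξ)
    (bound := fun ξ => S * ‖f ξ‖) Filter.univ_mem
    (.of_forall fun s => (integrable_conj_mul _ f).aestronglyMeasurable)
    (integrable_conj_mul _ f) (integrable_conj_mul _ f).aestronglyMeasurable
    (.of_forall fun ξ s _ => ?_) (f.integrable.norm.const_mul S)
    (.of_forall fun ξ s _ => ?_)).2
  · rw [norm_mul, RCLike.norm_conj, norm_weylOp_apply]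
    exact mul_le_mul_of_nonneg_right (hS _) (norm_nonneg _)
  · exact ((weylOp_smul_hasDerivAt Z g ξ s).star).mul_const _

/-! ### The inner product of the constrained system -/

section PhysInner

variable {L : Submodule ℝ (Phase ℝ n)} {μ : Measure L}

theorem physInner_eq (f g : 𝓢(Fin n → ℝ, ℂ)) :
    physInner L μ f g = ∫ X : L, l2Inner f (weylOp X g) ∂μ := by
  simp only [physInner, weyl_eq_weylOp]

theorem physInner_smul_right (c : ℂ) (f g : 𝓢(Fin n → ℝ, ℂ)) :
    physInner L μ f (c • g) = c * physInner L μ f g := by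
  simp only [physInner_eq, map_smul, l2Inner_smul_right, integral_const_mul]

/-- For Y skew to L, Ω(Ȳ) commutes with all the Weyl operators being averaged, so the L² adjoint
passes through the average. -/
theorem physInner_Omega_left {Y : Phase ℂ n} (hY : ∀ X ∈ L, omega Y X.toComplex = 0)
    (f g : 𝓢(Fin n → ℝ, ℂ)) :
    physInner L μ (Omega Y f) g = physInner L μ f (Omega Y.conj g) := by
  rw [physInner_eq, physInner_eq]
  refine integral_congr_ae (.of_forall fun X => ?_)
  have h : omega Y.conj (X : Phase ℝ n).toComplex = 0 := by
    rw [← Phase.conj_toComplex, omega_conj, hY X X.2, map_zero]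
  simp only [l2Inner_Omega_left, Omega_weylOp, h, zero_smul, add_zero]

variable [μ.IsAddHaarMeasure]

theorem integrable_l2Inner_weylOp (f g : 𝓢(Fin n → ℝ, ℂ)) :
    Integrable (fun X : L => l2Inner f (weylOp X g)) μ := by
  obtain ⟨C, -, hC⟩ := exists_norm_l2Inner_weylOp_le_inv_pow (n + n + 1) f g
  refine ((integrable_inv_one_add_norm_pow μ (finrank_submodule_lt L)).const_mul C).mono'
    ((continuous_l2Inner_weylOp f g).comp continuous_subtype_val).aestronglyMeasurable
    (.of_forall fun X => hC X)

theorem physInner_add_right (f g h : 𝓢(Fin n → ℝ, ℂ)) :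
    physInner L μ f (g + h) = physInner L μ f g + physInner L μ f h := by
  simp only [physInner_eq, map_add, l2Inner_add_right]
  exact integral_add (integrable_l2Inner_weylOp f g) (integrable_l2Inner_weylOp f h)

/-- Adjoints replace X by −X, which preserves the Haar measure. -/
theorem physInner_conj_symm (f g : 𝓢(Fin n → ℝ, ℂ)) :
    conj (physInner L μ g f) = physInner L μ f g := by
  have : ProperSpace L := FiniteDimensional.proper_real L
  rw [physInner_eq, physInner_eq, ← integral_conj, ← integral_neg_eq_self]
  refine integral_congr_ae (.of_forall fun X => ?_)
  simp only [Submodule.coe_neg]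
  rw [l2Inner_conj_symm, l2Inner_weylOp_left, neg_neg]

theorem physInner_add_left (f g h : 𝓢(Fin n → ℝ, ℂ)) :
    physInner L μ (f + g) h = physInner L μ f h + physInner L μ g h := by
  rw [← physInner_conj_symm, physInner_add_right, map_add, physInner_conj_symm,
    physInner_conj_symm]

theorem physInner_smul_left (c : ℂ) (f g : 𝓢(Fin n → ℝ, ℂ)) :
    physInner L μ (c • f) g = conj c * physInner L μ f g := by
  rw [← physInner_conj_symm, physInner_smul_right, map_mul, physInner_conj_symm]

/-- Isotropy removes the cocycle from W(X)W(Z), and translation invariance of μ absorbs Z. -/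
theorem physInner_weylOp_right (hL : IsIsotropic L) (Z : L) (f g : 𝓢(Fin n → ℝ, ℂ)) :
    physInner L μ f (weylOp Z g) = physInner L μ f g := by
  rw [physInner_eq, physInner_eq,
    ← integral_add_right_eq_self (fun X : L => l2Inner f (weylOp X g)) Z]
  refine integral_congr_ae (.of_forall fun X => ?_)
  simp only [weylOp_weylOp, hL X X.2 Z Z.2, Complex.ofReal_zero, mul_zero, Complex.exp_zero,
    one_smul, Submodule.coe_add]

theorem physInner_weylOp_smul_hasDerivAt (Z : Phase ℝ n) (g f : 𝓢(Fin n → ℝ, ℂ)) (t : ℝ) :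
    HasDerivAt (fun s : ℝ => physInner L μ (weylOp (s • Z) g) f)
      (physInner L μ (weylOp (t • Z) (Complex.I • Omega Z.toComplex g)) f) t := by
  obtain ⟨g', hg'⟩ : ∃ g', g' = Complex.I • Omega Z.toComplex g := ⟨_, rfl⟩
  rw [← hg']
  obtain ⟨C, hC0, hC⟩ := exists_norm_l2Inner_weylOp_le_inv_pow (n + n + 1) g' f
  simp only [physInner_eq]
  -- Domination uniform in s near t: Peetre's inequality moves the translation by sZ into a
  -- constant, with |s| ≤ |t| + 1.
  have hbound : ∀ X : L, ∀ s ∈ Metric.ball t 1,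
      ‖l2Inner (weylOp (s • Z) g') (weylOp (X : Phase ℝ n) f)‖
        ≤ C * ((1 + (|t| + 1) * ‖Z‖) ^ (n + n + 1) * ((1 + ‖X‖) ^ (n + n + 1))⁻¹) := by
    intro X s hs
    rw [norm_l2Inner_weylOp_weylOp]
    refine (hC _).trans (mul_le_mul_of_nonneg_left ?_ hC0)
    refine (inv_one_add_norm_sub_pow_le _ _ _).trans ?_
    have hs' : |s| ≤ |t| + 1 := by
      have h1 : |s - t| < 1 := by simpa [Real.dist_eq] using hs
      have h2 := abs_sub_abs_le_abs_sub s t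
      linarith
    rw [norm_smul, Real.norm_eq_abs, Submodule.coe_norm]
    gcongr
  have hint := ((integrable_inv_one_add_norm_pow μ (finrank_submodule_lt L)).const_mul
    ((1 + (|t| + 1) * ‖Z‖) ^ (n + n + 1))).const_mul C
  have hderiv : ∀ X : L, ∀ s ∈ Metric.ball t 1,
      HasDerivAt (fun s : ℝ => l2Inner (weylOp (s • Z) g) (weylOp (X : Phase ℝ n) f))
        (l2Inner (weylOp (s • Z) g') (weylOp (X : Phase ℝ n) f)) s := by
    intro X s _
    rw [hg']
    exact l2Inner_weylOp_smul_hasDerivAt Z g (weylOp (X : Phase ℝ n) f) s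
  exact (hasDerivAt_integral_of_dominated_loc_of_deriv_le (Metric.ball_mem_nhds t one_pos)
    (.of_forall fun s => (integrable_l2Inner_weylOp (weylOp (s • Z) g) f).aestronglyMeasurable)
    (integrable_l2Inner_weylOp (weylOp (t • Z) g) f)
    (integrable_l2Inner_weylOp (weylOp (t • Z) g') f).aestronglyMeasurable
    (.of_forall hbound) hint (.of_forall hderiv)).2

end PhysInner

/-! ### Positivity of the inner product -/

/-- The Euclidean square norm on phase space. -/
def phaseSq (X : Phase ℝ n) : ℝ := ∑ j, (X.1 j ^ 2 + X.2 j ^ 2)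

theorem continuous_phaseSq : Continuous (phaseSq (n := n)) := by
  unfold phaseSq
  fun_prop

theorem norm_sq_le_phaseSq (X : Phase ℝ n) : ‖X‖ ^ 2 ≤ phaseSq X := by
  have h0 : ∀ j ∈ Finset.univ, 0 ≤ X.1 j ^ 2 + X.2 j ^ 2 := fun j _ => by positivity
  have h : ∀ j, X.1 j ^ 2 + X.2 j ^ 2 ≤ phaseSq X := fun j =>
    Finset.single_le_sum h0 (Finset.mem_univ j)
  have hq : 0 ≤ phaseSq X := Finset.sum_nonneg h0
  have : ‖X‖ ≤ √(phaseSq X) := by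
    refine norm_prod_le_iff.2 ⟨?_, ?_⟩ <;>
      refine (pi_norm_le_iff_of_nonneg (Real.sqrt_nonneg _)).2 fun j => Real.abs_le_sqrt ?_ <;>
      nlinarith [h j, sq_nonneg (X.1 j), sq_nonneg (X.2 j)]
  calc ‖X‖ ^ 2 ≤ √(phaseSq X) ^ 2 := by gcongr
    _ = phaseSq X := Real.sq_sqrt hq

theorem phaseSq_nonneg (X : Phase ℝ n) : 0 ≤ phaseSq X :=
  (sq_nonneg ‖X‖).trans (norm_sq_le_phaseSq X)

/-- A parallelogram identity, unavailable for the sup norm carried by `Phase`. It makes the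
autocorrelation of a Gaussian weight again a Gaussian. -/
theorem phaseSq_add_phaseSq (X Y : Phase ℝ n) :
    phaseSq X + phaseSq (X + Y) = 2 * phaseSq (X + (1 / 2 : ℝ) • Y) + phaseSq Y / 2 := by
  simp only [phaseSq, Finset.mul_sum, Finset.sum_div, ← Finset.sum_add_distrib]
  refine Finset.sum_congr rfl fun j _ => ?_
  simp only [Prod.fst_add, Prod.snd_add, Pi.add_apply, Prod.smul_fst, Prod.smul_snd, Pi.smul_apply,
    smul_eq_mul]
  ring

section PhysInner

variable {L : Submodule ℝ (Phase ℝ n)} {μ : Measure L}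

/-- Dominated convergence removes the Gaussian regularization, along ε = 1/(k + 1). -/
theorem tendsto_integral_damped {F : L → ℂ} (hF : Integrable F μ) :
    Filter.Tendsto (fun k : ℕ => ∫ Y : L,
      (Real.exp (-(1 / ((k : ℝ) + 1)) * phaseSq (Y : Phase ℝ n)) : ℂ) * F Y ∂μ) Filter.atTop
      (nhds (∫ Y : L, F Y ∂μ)) := by
  refine tendsto_integral_of_dominated_convergence (fun Y : L => ‖F Y‖)
    (fun k => ?_) hF.norm (fun k => .of_forall fun Y => ?_) (.of_forall fun Y => ?_)
  · refine AEStronglyMeasurable.mul ?_ hF.aestronglyMeasurable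
    refine Continuous.aestronglyMeasurable ?_
    exact Complex.continuous_ofReal.comp (Real.continuous_exp.comp
      ((continuous_phaseSq.comp continuous_subtype_val).const_mul _))
  · rw [norm_mul, Complex.norm_real, Real.norm_of_nonneg (Real.exp_nonneg _)]
    refine mul_le_of_le_one_left (norm_nonneg _) (Real.exp_le_one_iff.2 ?_)
    have := phaseSq_nonneg (Y : Phase ℝ n)
    have : 0 ≤ 1 / ((k : ℝ) + 1) := by positivity
    nlinarith
  · have h1 : Filter.Tendsto (fun k : ℕ =>
        (Real.exp (-(1 / ((k : ℝ) + 1)) * phaseSq (Y : Phase ℝ n)) : ℂ)) Filter.atTop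
        (nhds 1) := by
      have h2 := (Complex.continuous_ofReal.tendsto _).comp
        (((tendsto_one_div_add_atTop_nhds_zero_nat (𝕜 := ℝ)).neg.mul_const
          (phaseSq (Y : Phase ℝ n))).rexp)
      simpa [Function.comp_def] using h2
    simpa using h1.mul_const (F Y)

variable [μ.IsAddHaarMeasure]

theorem integrable_exp_neg_phaseSq {ε : ℝ} (hε : 0 < ε) :
    Integrable (fun X : L => Real.exp (-ε * phaseSq (X : Phase ℝ n))) μ := by
  refine ((integrable_inv_one_add_norm_pow μ (finrank_submodule_lt L)).const_mul
    ((n + n + 1).factorial * Real.exp (1 + 1 / (4 * ε)))).mono' ?_ (.of_forall fun X => ?_)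
  · exact (Real.continuous_exp.comp ((continuous_phaseSq.comp
      continuous_subtype_val).const_mul _)).aestronglyMeasurable
  · rw [Real.norm_of_nonneg (Real.exp_nonneg _), ← div_eq_mul_inv, le_div_iff₀ (by positivity),
      mul_comm]
    refine le_trans ?_ (one_add_pow_mul_exp_le (n + n + 1) hε (norm_nonneg X))
    have : -ε * phaseSq (X : Phase ℝ n) ≤ -ε * ‖X‖ ^ 2 := by
      have := norm_sq_le_phaseSq (X : Phase ℝ n)
      rw [Submodule.coe_norm]
      nlinarith
    gcongr

theorem integrable_weighted_weylOp {w : L → ℝ} (hw : Integrable w μ) (hwc : Continuous w)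
    (g : 𝓢(Fin n → ℝ, ℂ)) :
    Integrable (Function.uncurry fun (ξ : Fin n → ℝ) (p : L × L) =>
      conj ((w p.1 : ℂ) * weylOp (p.1 : Phase ℝ n) g ξ) *
        ((w p.2 : ℂ) * weylOp (p.2 : Phase ℝ n) g ξ)) (volume.prod (μ.prod μ)) := by
  have : ProperSpace L := FiniteDimensional.proper_real L
  obtain ⟨S, hS0, hS⟩ := exists_norm_apply_le g
  have hcont : ∀ f : (Fin n → ℝ) × (L × L) → L, Continuous f →
      Continuous fun q : (Fin n → ℝ) × (L × L) => (w (f q) : ℂ) * weylOp (f q : Phase ℝ n) g q.1 := by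
    intro f hf
    refine (Complex.continuous_ofReal.comp (hwc.comp hf)).mul ?_
    exact (continuous_weylOp_apply g).comp₂ (continuous_subtype_val.comp hf) continuous_fst
  have hmeas : Continuous (Function.uncurry fun (ξ : Fin n → ℝ) (p : L × L) =>
      conj ((w p.1 : ℂ) * weylOp (p.1 : Phase ℝ n) g ξ) *
        ((w p.2 : ℂ) * weylOp (p.2 : Phase ℝ n) g ξ)) :=
    (Complex.continuous_conj.comp (hcont (fun q => q.2.1) (by fun_prop))).mul
      (hcont (fun q => q.2.2) (by fun_prop))
  have hint : ∀ p : L × L, Integrable (fun ξ =>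
      conj ((w p.1 : ℂ) * weylOp (p.1 : Phase ℝ n) g ξ) *
        ((w p.2 : ℂ) * weylOp (p.2 : Phase ℝ n) g ξ)) := fun p =>
    integrable_conj_mul ((w p.1 : ℂ) • weylOp (p.1 : Phase ℝ n) g)
      ((w p.2 : ℂ) • weylOp (p.2 : Phase ℝ n) g)
  rw [integrable_prod_iff' hmeas.aestronglyMeasurable]
  refine ⟨.of_forall hint, ?_⟩
  refine ((hw.norm.mul_prod hw.norm).mul_const (S * ∫ ξ, ‖g ξ‖)).mono'
    hmeas.norm.aestronglyMeasurable.prod_swap.integral_prod_right' (.of_forall fun p => ?_)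
  rw [Real.norm_of_nonneg (integral_nonneg fun _ => norm_nonneg _)]
  calc ∫ ξ, ‖conj ((w p.1 : ℂ) * weylOp (p.1 : Phase ℝ n) g ξ) *
        ((w p.2 : ℂ) * weylOp (p.2 : Phase ℝ n) g ξ)‖
      ≤ ∫ ξ, ‖w p.1‖ * ‖w p.2‖ * (S * ‖g (ξ - (p.2 : Phase ℝ n).2)‖) := by
        refine integral_mono (hint p).norm
          (((g.integrable.norm.comp_sub_right _).const_mul S).const_mul _) fun ξ => ?_
        simp only [norm_mul, RCLike.norm_conj, norm_weylOp_apply, Complex.norm_real]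
        have := hS (ξ - (p.1 : Phase ℝ n).2)
        calc _ = ‖w p.1‖ * ‖w p.2‖ * (‖g (ξ - (p.1 : Phase ℝ n).2)‖ *
              ‖g (ξ - (p.2 : Phase ℝ n).2)‖) := by ring
          _ ≤ _ := by gcongr
    _ = _ := by
        rw [integral_const_mul, integral_const_mul,
          integral_sub_right_eq_self (fun ξ => ‖g ξ‖)]

/-- By Fubini the double integral is the squared L² norm of the smeared function ∫ w(X) W(X)g dμ(X).
-/
theorem weighted_l2Inner_nonneg {w : L → ℝ} (hw : Integrable w μ) (hwc : Continuous w)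
    (g : 𝓢(Fin n → ℝ, ℂ)) :
    0 ≤ (∫ p : L × L, (w p.1 * w p.2 : ℝ) *
      l2Inner (weylOp (p.1 : Phase ℝ n) g) (weylOp (p.2 : Phase ℝ n) g) ∂(μ.prod μ)).re := by
  have : ProperSpace L := FiniteDimensional.proper_real L
  have h1 : ∫ p : L × L, (w p.1 * w p.2 : ℝ) *
      l2Inner (weylOp (p.1 : Phase ℝ n) g) (weylOp (p.2 : Phase ℝ n) g) ∂(μ.prod μ)
      = ∫ p : L × L, (∫ ξ, conj ((w p.1 : ℂ) * weylOp (p.1 : Phase ℝ n) g ξ) *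
        ((w p.2 : ℂ) * weylOp (p.2 : Phase ℝ n) g ξ)) ∂(μ.prod μ) := by
    refine integral_congr_ae (.of_forall fun p => ?_)
    simp only [l2Inner, ← integral_const_mul]
    refine integral_congr_ae (.of_forall fun ξ => ?_)
    simp only [map_mul, Complex.conj_ofReal, Complex.ofReal_mul]
    ring
  rw [h1, ← integral_integral_swap (integrable_weighted_weylOp hw hwc g)]
  have h2 : ∀ ξ, ∫ p : L × L, conj ((w p.1 : ℂ) * weylOp (p.1 : Phase ℝ n) g ξ) *
        ((w p.2 : ℂ) * weylOp (p.2 : Phase ℝ n) g ξ) ∂(μ.prod μ)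
      = ((‖∫ X : L, (w X : ℂ) * weylOp (X : Phase ℝ n) g ξ ∂μ‖ ^ 2 : ℝ) : ℂ) := by
    intro ξ
    rw [integral_prod_mul (fun X : L => conj ((w X : ℂ) * weylOp (X : Phase ℝ n) g ξ))
      (fun X : L => (w X : ℂ) * weylOp (X : Phase ℝ n) g ξ), integral_conj, Complex.conj_mul',
      Complex.ofReal_pow]
  simp only [h2]
  rw [integral_complex_ofReal, Complex.ofReal_re]
  exact integral_nonneg fun ξ => by positivity

/-- By isotropy (W(X)g, W(X')g) depends only on X' − X. The double integral of
`weighted_l2Inner_nonneg` thus becomes an integral over Y = X' − X against the autocorrelation of w,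
a positive multiple of e^{−ε|Y|²}. -/
theorem damped_physInner_self_nonneg (hL : IsIsotropic L) {ε : ℝ} (hε : 0 < ε)
    (g : 𝓢(Fin n → ℝ, ℂ)) :
    0 ≤ (∫ Y : L, (Real.exp (-ε * phaseSq (Y : Phase ℝ n)) : ℂ) *
      l2Inner g (weylOp (Y : Phase ℝ n) g) ∂μ).re := by
  have : ProperSpace L := FiniteDimensional.proper_real L
  -- With rate 2ε, `phaseSq_add_phaseSq` gives w(X)w(X+Y) = e^{−4ε|X+Y/2|²} e^{−ε|Y|²}; integrating
  -- over X leaves the constant K.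
  set w : L → ℝ := fun X => Real.exp (-(2 * ε) * phaseSq (X : Phase ℝ n)) with hw
  have hwi : Integrable w μ := integrable_exp_neg_phaseSq (by positivity)
  have hwc : Continuous w := Real.continuous_exp.comp
    ((continuous_phaseSq.comp continuous_subtype_val).const_mul _)
  have hw1 : ∀ X, ‖w X‖ ≤ 1 := fun X => by
    rw [hw, Real.norm_of_nonneg (Real.exp_nonneg _), Real.exp_le_one_iff]
    nlinarith [phaseSq_nonneg (X : Phase ℝ n)]
  set F : L → ℂ := fun Y => l2Inner g (weylOp (Y : Phase ℝ n) g) with hF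
  have hFi : Integrable F μ := integrable_l2Inner_weylOp g g
  have hFc : Continuous F := (continuous_l2Inner_weylOp g g).comp continuous_subtype_val
  obtain ⟨C, hC⟩ : ∃ C, ∀ Y, ‖F Y‖ ≤ C :=
    (exists_norm_l2Inner_weylOp_le g g).imp fun C hC Y => hC Y
  have hFF : ∀ p : L × L, l2Inner (weylOp (p.1 : Phase ℝ n) g) (weylOp (p.2 : Phase ℝ n) g)
      = F (p.2 - p.1) := by
    intro p
    rw [l2Inner_weylOp_weylOp, hL p.1 p.1.2 p.2 p.2.2]
    simp [hF]
  set K : ℝ := ∫ X : L, Real.exp (-(4 * ε) * phaseSq (X : Phase ℝ n)) ∂μ with hK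
  have hKpos : 0 < K :=
    integral_exp_pos (integrable_exp_neg_phaseSq (by positivity))
  have hpos := weighted_l2Inner_nonneg hwi hwc g
  simp only [hFF] at hpos
  have hint1 : Integrable (fun p : L × L => ((w p.1 * w p.2 : ℝ) : ℂ) * F (p.2 - p.1))
      (μ.prod μ) := by
    refine ((hwi.norm.mul_prod hwi.norm).mul_const C).mono' ?_ (.of_forall fun p => ?_)
    · exact Continuous.aestronglyMeasurable (by fun_prop)
    · rw [norm_mul, Complex.norm_real, norm_mul]
      exact mul_le_mul_of_nonneg_left (hC _) (by positivity)
  have hint2 : Integrable (Function.uncurry fun (X Y : L) => ((w X * w (Y + X) : ℝ) : ℂ) * F Y)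
      (μ.prod μ) := by
    refine (hwi.norm.mul_prod hFi.norm).mono' ?_ (.of_forall fun p => ?_)
    · refine Continuous.aestronglyMeasurable ?_
      unfold Function.uncurry
      fun_prop
    · simp only [Function.uncurry, norm_mul, Complex.norm_real]
      refine mul_le_mul_of_nonneg_right ?_ (norm_nonneg _)
      exact mul_le_of_le_one_right (norm_nonneg _) (hw1 _)
  have heq : ∫ p : L × L, ((w p.1 * w p.2 : ℝ) : ℂ) * F (p.2 - p.1) ∂(μ.prod μ)
      = (K : ℂ) * ∫ Y : L, (Real.exp (-ε * phaseSq (Y : Phase ℝ n)) : ℂ) * F Y ∂μ := by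
    rw [integral_prod _ hint1]
    have h1 : ∀ X : L, ∫ X' : L, ((w X * w X' : ℝ) : ℂ) * F (X' - X) ∂μ
        = ∫ Y : L, ((w X * w (Y + X) : ℝ) : ℂ) * F Y ∂μ := fun X => by
      rw [← integral_add_right_eq_self (fun X' : L => ((w X * w X' : ℝ) : ℂ) * F (X' - X)) X]
      simp only [add_sub_cancel_right]
    simp only [h1]
    rw [integral_integral_swap hint2, ← integral_const_mul]
    refine integral_congr_ae (.of_forall fun Y => ?_)
    simp only
    rw [integral_mul_const, integral_complex_ofReal, ← mul_assoc]
    congr 1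
    rw [← Complex.ofReal_mul]
    congr 1
    rw [hK, ← integral_mul_const, ← integral_add_right_eq_self
      (fun X : L => Real.exp (-(4 * ε) * phaseSq (X : Phase ℝ n)) * _) ((1 / 2 : ℝ) • Y)]
    refine integral_congr_ae (.of_forall fun X => ?_)
    simp only [hw, ← Real.exp_add]
    congr 1
    have := phaseSq_add_phaseSq (X : Phase ℝ n) Y
    simp only [Submodule.coe_add, Submodule.coe_smul]
    rw [add_comm (Y : Phase ℝ n)]
    linear_combination (-2 * ε) * this
  rw [heq, Complex.re_ofReal_mul] at hpos
  exact nonneg_of_mul_nonneg_right hpos hKpos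

theorem physInner_self_re_nonneg (hL : IsIsotropic L) (g : 𝓢(Fin n → ℝ, ℂ)) :
    0 ≤ (physInner L μ g g).re := by
  rw [physInner_eq]
  have hlim := tendsto_integral_damped (integrable_l2Inner_weylOp (L := L) (μ := μ) g g)
  refine ge_of_tendsto ((Complex.continuous_re.tendsto _).comp hlim) (.of_forall fun k => ?_)
  exact damped_physInner_self_nonneg hL (by positivity) g

/-- The inner product of the constrained system is positive semidefinite. -/
abbrev physCore (hL : IsIsotropic L) (μ : Measure L) [μ.IsAddHaarMeasure] :
    PreInnerProductSpace.Core ℂ 𝓢(Fin n → ℝ, ℂ) where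
  inner := physInner L μ
  conj_inner_symm := physInner_conj_symm
  re_inner_nonneg := physInner_self_re_nonneg hL
  add_left := physInner_add_left
  smul_left f g c := physInner_smul_left c f g

/-- Cauchy–Schwarz for the semidefinite form: zero norm means lying in the radical, a condition
linear in f. -/
theorem IsNull.physInner_right (hL : IsIsotropic L) {f : 𝓢(Fin n → ℝ, ℂ)} (hf : IsNull L μ f)
    (g : 𝓢(Fin n → ℝ, ℂ)) : physInner L μ g f = 0 := by
  have h := @InnerProductSpace.Core.inner_mul_inner_self_le ℂ _ _ _ _ (physCore hL μ) g f
  change ‖physInner L μ g f‖ * ‖physInner L μ f g‖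
    ≤ (physInner L μ g g).re * (physInner L μ f f).re at h
  rw [show physInner L μ f f = 0 from hf, Complex.zero_re, mul_zero, ← physInner_conj_symm f g,
    RCLike.norm_conj] at h
  exact norm_eq_zero.1 (mul_self_eq_zero.1 (le_antisymm h (mul_self_nonneg _)))

theorem isNull_iff (hL : IsIsotropic L) {f : 𝓢(Fin n → ℝ, ℂ)} :
    IsNull L μ f ↔ ∀ g, physInner L μ g f = 0 :=
  ⟨fun h g => h.physInner_right hL g, fun h => h f⟩

/-- The null vectors form a subspace. -/
def nullSubmodule (hL : IsIsotropic L) (μ : Measure L) [μ.IsAddHaarMeasure] :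
    Submodule ℂ 𝓢(Fin n → ℝ, ℂ) where
  carrier := {f | IsNull L μ f}
  add_mem' {f g} hf hg := (isNull_iff hL).2 fun h => by
    rw [physInner_add_right, hf.physInner_right hL, hg.physInner_right hL, add_zero]
  zero_mem' := (isNull_iff hL).2 fun h => by
    rw [← zero_smul ℂ (0 : 𝓢(Fin n → ℝ, ℂ)), physInner_smul_right, zero_mul]
  smul_mem' c f hf := (isNull_iff hL).2 fun h => by
    rw [physInner_smul_right, hf.physInner_right hL, mul_zero]

theorem mem_nullSubmodule (hL : IsIsotropic L) {f : 𝓢(Fin n → ℝ, ℂ)} :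
    f ∈ nullSubmodule hL μ ↔ IsNull L μ f := Iff.rfl

/-- Observables of the constrained system preserve the null vectors. -/
theorem IsNull.Omega (hL : IsIsotropic L) {Y : Phase ℂ n}
    (hY : ∀ X ∈ L, omega Y X.toComplex = 0) {f : 𝓢(Fin n → ℝ, ℂ)} (hf : IsNull L μ f) :
    IsNull L μ (Omega Y f) := by
  change physInner L μ _ _ = 0
  rw [← physInner_conj_symm, ← Phase.conj_conj Y]
  have hY' : ∀ X ∈ L, omega Y.conj X.toComplex = 0 := fun X hX => by
    rw [← Phase.conj_toComplex, omega_conj, hY X hX, map_zero]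
  rw [← physInner_Omega_left hY', hf.physInner_right hL, map_zero]

/-- The constraints vanish on the constrained system. -/
theorem isNull_Omega_of_mem (hL : IsIsotropic L) {X : Phase ℝ n} (hX : X ∈ L)
    (f : 𝓢(Fin n → ℝ, ℂ)) : IsNull L μ (Omega X.toComplex f) := by
  refine (isNull_iff hL).2 fun g => ?_
  have h1 := physInner_weylOp_smul_hasDerivAt (L := L) (μ := μ) X f g 0
  -- The pairing is constant along the group generated by X ∈ L, so its derivative, which contains
  -- Ω(X)f, vanishes.
  have h2 : ∀ s : ℝ, physInner L μ (weylOp (s • X) f) g = physInner L μ f g := fun s => by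
    rw [← physInner_conj_symm, physInner_weylOp_right hL ⟨s • X, L.smul_mem s hX⟩,
      physInner_conj_symm]
  simp only [h2] at h1
  have h3 := h1.unique (hasDerivAt_const _ _)
  rw [zero_smul, weylOp_zero, physInner_smul_left, ← physInner_conj_symm, mul_eq_zero] at h3
  rcases h3 with h3 | h3
  · simp at h3
  · simpa using h3

theorem isNull_Omega_of_mem_span (hL : IsIsotropic L) {Y : Phase ℂ n}
    (hY : Y ∈ Submodule.span ℂ (Phase.toComplex '' (L : Set (Phase ℝ n))))
    (f : 𝓢(Fin n → ℝ, ℂ)) : IsNull L μ (Constrained.Omega Y f) := by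
  rw [← mem_nullSubmodule hL]
  induction hY using Submodule.span_induction with
  | mem Y hY =>
    obtain ⟨X, hX, rfl⟩ := hY
    exact isNull_Omega_of_mem hL hX f
  | zero => simp [Constrained.Omega]
  | add Y Z _ _ hY hZ =>
    rw [Omega_add]
    exact add_mem hY hZ
  | smul c Y _ hY =>
    rw [Omega_smul]
    exact Submodule.smul_mem _ c hY

end PhysInner

/-! ### Coherent states resolve the identity -/

/-- The Fourier integral with the kernel `e^{-iP·ξ}`. -/
def angularFourier (u : 𝓢(Fin n → ℝ, ℂ)) (P : Fin n → ℝ) : ℂ :=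
  ∫ ξ, Complex.exp (-Complex.I * ((∑ j, P j * ξ j : ℝ) : ℂ)) * u ξ

theorem fourier_euclidean_apply (u : 𝓢(Fin n → ℝ, ℂ)) (w : EuclideanSpace ℝ (Fin n)) :
    FourierTransform.fourier
      (compCLMOfContinuousLinearEquiv ℂ (EuclideanSpace.equiv (Fin n) ℝ) u) w
      = angularFourier u ((2 * Real.pi) • (w : Fin n → ℝ)) := by
  rw [SchwartzMap.fourier_coe, Real.fourier_eq', angularFourier,
    ← (PiLp.volume_preserving_toLp (Fin n)).integral_comp
      (MeasurableEquiv.toLp 2 (Fin n → ℝ)).measurableEmbedding]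
  refine integral_congr_ae (.of_forall fun ξ => ?_)
  have hu : compCLMOfContinuousLinearEquiv ℂ (EuclideanSpace.equiv (Fin n) ℝ) u
      (WithLp.toLp 2 ξ) = u ξ := rfl
  simp only [smul_eq_mul, hu]
  congr 2
  have : inner ℝ (WithLp.toLp 2 ξ) w = ∑ j, w j * ξ j := by
    simp [PiLp.inner_apply]
  rw [this]
  push_cast
  simp only [Finset.mul_sum, Finset.sum_mul, Pi.smul_apply, smul_eq_mul]
  refine Finset.sum_congr rfl fun j _ => ?_
  push_cast
  ring

/-- Plancherel, transported from the Euclidean space; rescaling the frequency by 2π produces the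
constant. -/
theorem integral_conj_angularFourier_mul (u v : 𝓢(Fin n → ℝ, ℂ)) :
    ∫ P, conj (angularFourier u P) * angularFourier v P
      = (2 * Real.pi : ℂ) ^ n * ∫ ξ, conj (u ξ) * v ξ := by
  have h := SchwartzMap.integral_sesq_fourier_fourier
    (compCLMOfContinuousLinearEquiv ℂ (EuclideanSpace.equiv (Fin n) ℝ) u)
    (compCLMOfContinuousLinearEquiv ℂ (EuclideanSpace.equiv (Fin n) ℝ) v) (innerSL ℂ)
  simp only [fourier_euclidean_apply, innerSL_apply_apply, RCLike.inner_apply'] at h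
  rw [← (PiLp.volume_preserving_toLp (Fin n)).integral_comp
      (MeasurableEquiv.toLp 2 (Fin n → ℝ)).measurableEmbedding,
    ← (PiLp.volume_preserving_toLp (Fin n)).integral_comp
      (MeasurableEquiv.toLp 2 (Fin n → ℝ)).measurableEmbedding,
    Measure.integral_comp_smul volume
      (fun P : Fin n → ℝ => conj (angularFourier u P) * angularFourier v P) (2 * Real.pi)] at h
  have h2 : ∫ ξ, conj (u ξ) * v ξ = |((2 * Real.pi) ^ n)⁻¹| •
      ∫ P, conj (angularFourier u P) * angularFourier v P := by
    rw [Module.finrank_fin_fun] at h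
    exact h.symm
  have hpi : (0 : ℝ) < (2 * Real.pi) ^ n := by positivity
  rw [h2, abs_of_pos (inv_pos.2 hpi), Complex.real_smul, ← mul_assoc]
  push_cast
  rw [mul_inv_cancel₀, one_mul]
  exact_mod_cast hpi.ne'

theorem norm_l2Inner_weylOp_left (Z : Phase ℝ n) (f g : 𝓢(Fin n → ℝ, ℂ)) :
    ‖l2Inner (weylOp Z f) g‖ = ‖l2Inner g (weylOp Z f)‖ := by
  rw [← l2Inner_conj_symm, RCLike.norm_conj]

theorem continuous_l2Inner_weylOp_left (f g : 𝓢(Fin n → ℝ, ℂ)) :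
    Continuous fun Z : Phase ℝ n => l2Inner (weylOp Z f) g := by
  have h := Complex.continuous_conj.comp (continuous_l2Inner_weylOp g f)
  exact h.congr fun Z => l2Inner_conj_symm _ _

/-- For fixed Q, the coefficient is, up to a phase, a Fourier transform in P; Plancherel can then be
used in the P variable. -/
theorem l2Inner_weylOp_eq_angularFourier (Z : Phase ℝ n) (ψ f : 𝓢(Fin n → ℝ, ℂ)) :
    l2Inner (weylOp Z ψ) f = Complex.exp (Complex.I * ((∑ j, Z.1 j * Z.2 j) / 2 : ℝ)) *
      angularFourier (SchwartzMap.pairing (ContinuousLinearMap.mul ℝ ℂ)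
        (conjSchwartz (SchwartzMap.compSubConstCLM ℂ Z.2 ψ)) f) Z.1 := by
  simp only [l2Inner, angularFourier, ← integral_const_mul]
  refine integral_congr_ae (.of_forall fun ξ => ?_)
  simp only [weylOp_apply, weylPhase, map_mul, ← Complex.exp_conj, Complex.conj_I,
    Complex.conj_ofReal]
  rw [SchwartzMap.pairing_apply_apply, ContinuousLinearMap.mul_apply', conjSchwartz_apply,
    SchwartzMap.compSubConstCLM_apply, ← mul_assoc, ← Complex.exp_add, mul_assoc]
  congr 2
  push_cast
  ring

instance isAddHaarMeasure_volume_phase : (volume : Measure (Phase ℝ n)).IsAddHaarMeasure :=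
  Measure.prod.instIsAddHaarMeasure _ _

theorem integrable_conj_mul_l2Inner_weylOp (ψ f g : 𝓢(Fin n → ℝ, ℂ)) :
    Integrable fun Z : Phase ℝ n => conj (l2Inner (weylOp Z ψ) g) * l2Inner (weylOp Z ψ) f := by
  obtain ⟨C, hC0, hC⟩ := exists_norm_l2Inner_weylOp_le_inv_pow (n + n + 1) g ψ
  obtain ⟨D, hD⟩ := exists_norm_l2Inner_weylOp_le f ψ
  have hi := integrable_inv_one_add_norm_pow (volume : Measure (Phase ℝ n))
    (finrank_phase.trans_lt (Nat.lt_succ_self (n + n)))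
  refine ((hi.const_mul C).mul_const D).mono'
    (((Complex.continuous_conj.comp (continuous_l2Inner_weylOp_left ψ g)).mul
      (continuous_l2Inner_weylOp_left ψ f)).aestronglyMeasurable) (.of_forall fun Z => ?_)
  rw [norm_mul, RCLike.norm_conj, norm_l2Inner_weylOp_left, norm_l2Inner_weylOp_left]
  exact mul_le_mul (hC Z) (hD Z) (norm_nonneg _) (mul_nonneg hC0 (by positivity))

/-- The Moyal identity. -/
theorem integral_conj_mul_l2Inner_weylOp (ψ f g : 𝓢(Fin n → ℝ, ℂ)) :
    ∫ Z : Phase ℝ n, conj (l2Inner (weylOp Z ψ) g) * l2Inner (weylOp Z ψ) f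
      = (2 * Real.pi : ℂ) ^ n * l2Inner ψ ψ * l2Inner g f := by
  have hint := integrable_conj_mul_l2Inner_weylOp ψ f g
  rw [Measure.volume_eq_prod] at hint ⊢
  rw [integral_prod_symm _ hint]
  -- Plancherel in P; the phases cancel. The remaining Q integral over |ψ(ξ − Q)|² then factors off
  -- as (ψ, ψ).
  have h1 : ∀ Q : Fin n → ℝ, ∫ P : Fin n → ℝ, conj (l2Inner (weylOp (P, Q) ψ) g) *
        l2Inner (weylOp (P, Q) ψ) f
      = (2 * Real.pi : ℂ) ^ n * ∫ ξ, conj (ψ (ξ - Q)) * ψ (ξ - Q) * (conj (g ξ) * f ξ) := by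
    intro Q
    have h2 := integral_conj_angularFourier_mul
      (SchwartzMap.pairing (ContinuousLinearMap.mul ℝ ℂ)
        (conjSchwartz (SchwartzMap.compSubConstCLM ℂ Q ψ)) g)
      (SchwartzMap.pairing (ContinuousLinearMap.mul ℝ ℂ)
        (conjSchwartz (SchwartzMap.compSubConstCLM ℂ Q ψ)) f)
    have h3 : ∫ ξ, conj (ψ (ξ - Q)) * ψ (ξ - Q) * (conj (g ξ) * f ξ)
        = ∫ ξ, conj ((SchwartzMap.pairing (ContinuousLinearMap.mul ℝ ℂ)
          (conjSchwartz (SchwartzMap.compSubConstCLM ℂ Q ψ)) g) ξ) *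
          (SchwartzMap.pairing (ContinuousLinearMap.mul ℝ ℂ)
          (conjSchwartz (SchwartzMap.compSubConstCLM ℂ Q ψ)) f) ξ := by
      refine integral_congr_ae (.of_forall fun ξ => ?_)
      simp only [SchwartzMap.pairing_apply_apply, ContinuousLinearMap.mul_apply',
        conjSchwartz_apply, SchwartzMap.compSubConstCLM_apply, map_mul, Complex.conj_conj]
      ring
    rw [h3, ← h2]
    refine integral_congr_ae (.of_forall fun P => ?_)
    simp only [l2Inner_weylOp_eq_angularFourier, map_mul]
    rw [mul_mul_mul_comm, Complex.conj_mul', mul_comm Complex.I, Complex.norm_exp_ofReal_mul_I]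
    simp
  simp only [h1]
  rw [integral_const_mul, mul_assoc]
  congr 1
  have hswap : Integrable (Function.uncurry fun (Q ξ : Fin n → ℝ) =>
      conj (ψ (ξ - Q)) * ψ (ξ - Q) * (conj (g ξ) * f ξ)) (volume.prod volume) := by
    have hc : Continuous (Function.uncurry fun (Q ξ : Fin n → ℝ) =>
        conj (ψ (ξ - Q)) * ψ (ξ - Q) * (conj (g ξ) * f ξ)) := by
      have h1 := ψ.continuous
      have h2 := g.continuous
      have h3 := f.continuous
      unfold Function.uncurry
      fun_prop
    rw [integrable_prod_iff' hc.aestronglyMeasurable]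
    refine ⟨.of_forall fun ξ => ?_, ?_⟩
    · exact ((integrable_conj_mul ψ ψ).comp_sub_left ξ).mul_const (conj (g ξ) * f ξ)
    · have h4 : ∀ ξ, ∫ Q, ‖conj (ψ (ξ - Q)) * ψ (ξ - Q) * (conj (g ξ) * f ξ)‖
          = (∫ Q, ‖conj (ψ Q) * ψ Q‖) * ‖conj (g ξ) * f ξ‖ := fun ξ => by
        simp only [norm_mul _ (conj (g ξ) * f ξ), integral_mul_const]
        rw [integral_sub_left_eq_self (fun Q => ‖conj (ψ Q) * ψ Q‖)]
      simp only [Function.uncurry, h4]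
      exact (integrable_conj_mul g f).norm.const_mul _
  rw [integral_integral_swap hswap]
  simp only [integral_mul_const]
  rw [l2Inner, l2Inner, ← integral_const_mul]
  refine integral_congr_ae (.of_forall fun ξ => ?_)
  simp only
  rw [integral_sub_left_eq_self (fun Q => conj (ψ Q) * ψ Q)]

/-- Insert the Moyal resolution into (f, W(X)f) and integrate over L first: the inner integral is
⟨W(Z)ψ, f⟩ = 0. -/
theorem isNull_of_physInner_weylOp_eq_zero {L : Submodule ℝ (Phase ℝ n)} {μ : Measure L}
    [μ.IsAddHaarMeasure] {ψ f : 𝓢(Fin n → ℝ, ℂ)} (hψ : l2Inner ψ ψ ≠ 0)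
    (h : ∀ Z : Phase ℝ n, physInner L μ (weylOp Z ψ) f = 0) : IsNull L μ f := by
  have : ProperSpace L := FiniteDimensional.proper_real L
  have hpi : (2 * Real.pi : ℂ) ^ n ≠ 0 := pow_ne_zero _ (by exact_mod_cast Real.two_pi_pos.ne')
  set N := n + n + 1 with hN
  -- One N pays for the growth in Z from Peetre's inequality, the other for integrability in Z.
  obtain ⟨C, hC0, hC⟩ := exists_norm_l2Inner_weylOp_le_inv_pow (N + N) f ψ
  obtain ⟨D, hD0, hD⟩ := exists_norm_l2Inner_weylOp_le_inv_pow N ψ f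
  have hint : Integrable (Function.uncurry fun (X : L) (Z : Phase ℝ n) =>
      conj (l2Inner (weylOp Z ψ) f) * l2Inner (weylOp Z ψ) (weylOp (X : Phase ℝ n) f))
      (μ.prod volume) := by
    have hi1 := integrable_inv_one_add_norm_pow μ (finrank_submodule_lt L)
    have hi2 := integrable_inv_one_add_norm_pow (volume : Measure (Phase ℝ n))
      (finrank_phase.trans_lt (Nat.lt_succ_self (n + n)))
    refine ((hi1.const_mul D).mul_prod (hi2.const_mul C)).mono' ?_ (.of_forall fun p => ?_)
    · refine Continuous.aestronglyMeasurable (Continuous.mul ?_ ?_)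
      · exact Complex.continuous_conj.comp
          ((continuous_l2Inner_weylOp_left ψ f).comp continuous_snd)
      · exact (continuous_l2Inner_weylOp_weylOp ψ f).comp₂ continuous_snd
          (continuous_subtype_val.comp continuous_fst)
    · rcases p with ⟨X, Z⟩
      simp only [Function.uncurry, norm_mul, RCLike.norm_conj]
      rw [norm_l2Inner_weylOp_left, norm_l2Inner_weylOp_weylOp]
      calc ‖l2Inner f (weylOp Z ψ)‖ * ‖l2Inner ψ (weylOp ((X : Phase ℝ n) - Z) f)‖
          ≤ (C * ((1 + ‖Z‖) ^ (N + N))⁻¹) *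
            (D * ((1 + ‖Z‖) ^ N * ((1 + ‖(X : Phase ℝ n)‖) ^ N)⁻¹)) := by
            refine mul_le_mul (hC Z) ((hD _).trans ?_) (norm_nonneg _)
              (mul_nonneg hC0 (by positivity))
            exact mul_le_mul_of_nonneg_left (inv_one_add_norm_sub_pow_le _ _ _) hD0
        _ = D * ((1 + ‖X‖) ^ N)⁻¹ * (C * ((1 + ‖Z‖) ^ N)⁻¹) := by
            rw [Submodule.coe_norm, pow_add]
            have : (1 + ‖Z‖) ^ N ≠ 0 := by positivity
            field_simp
  have key : (2 * Real.pi : ℂ) ^ n * l2Inner ψ ψ * physInner L μ f f = 0 := by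
    rw [physInner_eq, ← integral_const_mul]
    simp only [← integral_conj_mul_l2Inner_weylOp ψ]
    rw [integral_integral_swap hint]
    simp only [integral_const_mul, ← physInner_eq, h, mul_zero, integral_zero]
  exact (mul_eq_zero.1 key).resolve_left (mul_ne_zero hpi hψ)

/-! ### Gaussian states -/

/-- The bilinear form `∑_{jk} ξⱼ A_{jk} η_k`. -/
def bilin (A : Matrix (Fin n) (Fin n) ℂ) (ξ η : Fin n → ℝ) : ℂ :=
  ∑ j, ∑ k, (ξ j : ℂ) * A j k * (η k : ℂ)

theorem bilin_self (A : Matrix (Fin n) (Fin n) ℂ) (ξ : Fin n → ℝ) : bilin A ξ ξ = quad A ξ := rfl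

theorem bilin_add_right (A : Matrix (Fin n) (Fin n) ℂ) (ξ η ζ : Fin n → ℝ) :
    bilin A ξ (η + ζ) = bilin A ξ η + bilin A ξ ζ := by
  simp only [bilin, Pi.add_apply, Complex.ofReal_add, mul_add, Finset.sum_add_distrib]

theorem bilin_smul_right (A : Matrix (Fin n) (Fin n) ℂ) (r : ℝ) (ξ η : Fin n → ℝ) :
    bilin A ξ (r • η) = r * bilin A ξ η := by
  simp only [bilin, Pi.smul_apply, smul_eq_mul, Complex.ofReal_mul, Finset.mul_sum]
  exact Finset.sum_congr rfl fun j _ => Finset.sum_congr rfl fun k _ => by ring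

theorem bilin_comm {A : Matrix (Fin n) (Fin n) ℂ} (hA : A.IsSymm) (ξ η : Fin n → ℝ) :
    bilin A ξ η = bilin A η ξ := by
  rw [bilin, bilin, Finset.sum_comm]
  refine Finset.sum_congr rfl fun j _ => Finset.sum_congr rfl fun k _ => ?_
  rw [hA.apply]
  ring

theorem quad_add {A : Matrix (Fin n) (Fin n) ℂ} (hA : A.IsSymm) (ξ η : Fin n → ℝ) :
    quad A (ξ + η) = quad A ξ + 2 * bilin A η ξ + quad A η := by
  rw [← bilin_self, bilin_add_right, bilin_comm hA _ ξ, bilin_comm hA _ η, bilin_add_right,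
    bilin_add_right, bilin_self, bilin_self, bilin_comm hA ξ η]
  ring

theorem gaussian_apply (A : Matrix (Fin n) (Fin n) ℂ) (hA : ImPos A) (ξ : Fin n → ℝ) :
    gaussian A hA ξ = Complex.exp (Complex.I / 2 * quad A ξ) := rfl

/-- The symmetric part of a matrix. -/
def symPart (A : Matrix (Fin n) (Fin n) ℂ) : Matrix (Fin n) (Fin n) ℂ :=
  (1 / 2 : ℂ) • (A + A.transpose)

theorem symPart_isSymm (A : Matrix (Fin n) (Fin n) ℂ) : (symPart A).IsSymm := by
  rw [symPart, Matrix.IsSymm, Matrix.transpose_smul, Matrix.transpose_add,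
    Matrix.transpose_transpose, add_comm]

theorem quad_symPart (A : Matrix (Fin n) (Fin n) ℂ) (ξ : Fin n → ℝ) :
    quad (symPart A) ξ = quad A ξ := by
  have h : quad A.transpose ξ = quad A ξ := by
    rw [quad, Finset.sum_comm]
    refine Finset.sum_congr rfl fun j _ => Finset.sum_congr rfl fun k _ => ?_
    rw [Matrix.transpose_apply]
    ring
  have h2 : quad (symPart A) ξ = (1 / 2) * (quad A ξ + quad A.transpose ξ) := by
    simp only [quad, symPart, Matrix.smul_apply, Matrix.add_apply, smul_eq_mul, Finset.mul_sum,
      ← Finset.sum_add_distrib]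
    exact Finset.sum_congr rfl fun j _ => Finset.sum_congr rfl fun k _ => by ring
  rw [h2, h]
  ring

theorem ImPos.symPart {A : Matrix (Fin n) (Fin n) ℂ} (hA : ImPos A) : ImPos (symPart A) :=
  fun ξ hξ => by
    rw [quad_symPart]
    exact hA ξ hξ

theorem gaussian_symPart (A : Matrix (Fin n) (Fin n) ℂ) (hA : ImPos A) :
    gaussian (symPart A) hA.symPart = gaussian A hA := by
  ext ξ
  rw [gaussian_apply, gaussian_apply, quad_symPart]

/-- The linear form by which `Ω(Y)` multiplies the Gaussian state `ψ_A`. -/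
def gaussSymbol (A : Matrix (Fin n) (Fin n) ℂ) : Phase ℂ n →ₗ[ℂ] (Fin n → ℂ) :=
  LinearMap.fst ℂ _ _ - A.mulVecLin ∘ₗ LinearMap.snd ℂ _ _

theorem gaussSymbol_apply (A : Matrix (Fin n) (Fin n) ℂ) (Y : Phase ℂ n) :
    gaussSymbol A Y = Y.1 - A.mulVec Y.2 := rfl

theorem fderiv_gaussian {A : Matrix (Fin n) (Fin n) ℂ} (hs : A.IsSymm) (hA : ImPos A)
    (ξ v : Fin n → ℝ) :
    fderiv ℝ (gaussian A hA) ξ v = Complex.I * bilin A v ξ * gaussian A hA ξ := by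
  have h1 := ((gaussian A hA).hasFDerivAt ξ).hasLineDerivAt v
  have h2 : HasDerivAt (fun t : ℝ => Complex.I / 2 *
      (quad A ξ + 2 * (t * bilin A v ξ) + (t : ℂ) ^ 2 * quad A v))
      (Complex.I / 2 * (2 * (1 * bilin A v ξ) + (2 * ((0 : ℝ) : ℂ) * 1) * quad A v)) 0 := by
    have hid : HasDerivAt (fun t : ℝ => (t : ℂ)) 1 0 := (hasDerivAt_id (0 : ℝ)).ofReal_comp
    refine HasDerivAt.const_mul _ (HasDerivAt.add ?_ ?_)
    · exact ((hid.mul_const _).const_mul 2).const_add _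
    · simpa using (hid.pow 2).mul_const (quad A v)
  have h3 := h2.cexp
  have h4 : HasDerivAt (fun t : ℝ => gaussian A hA (ξ + t • v)) _ 0 :=
    h3.congr_of_eventuallyEq (.of_forall fun t => by
      simp only [gaussian_apply]
      rw [quad_add hs, quad_smul, bilin_comm hs, bilin_smul_right, bilin_comm hs])
  rw [HasDerivAt.unique h1 h4, gaussian_apply]
  simp
  ring

/-- On a Gaussian, Ω(Y) acts as multiplication by a linear form, so only P − AQ matters; it vanishes
exactly on the Lagrangian plane P = AQ. -/
theorem Omega_gaussian_apply {A : Matrix (Fin n) (Fin n) ℂ} (hs : A.IsSymm) (hA : ImPos A)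
    (Y : Phase ℂ n) (ξ : Fin n → ℝ) :
    Omega Y (gaussian A hA) ξ = (∑ j, gaussSymbol A Y j * ξ j) * gaussian A hA ξ := by
  have hb : ∀ j, bilin A (Pi.single j 1) ξ = ∑ k, A j k * ξ k := fun j => by
    rw [bilin, Finset.sum_eq_single j]
    · simp
    · intro i _ hi
      simp [hi]
    · simp
  have h2 : ∑ j, Y.2 j * ∑ k, A j k * (ξ k : ℂ) = ∑ j, A.mulVec Y.2 j * ξ j := by
    simp only [Matrix.mulVec, dotProduct, Finset.mul_sum, Finset.sum_mul]
    rw [Finset.sum_comm]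
    refine Finset.sum_congr rfl fun j _ => Finset.sum_congr rfl fun k _ => ?_
    rw [hs.apply]
    ring
  have hI := Complex.I_ne_zero
  have h3 : Omega Y (gaussian A hA) ξ
      = (∑ j, Y.1 j * ξ j - ∑ j, Y.2 j * ∑ k, A j k * (ξ k : ℂ)) * gaussian A hA ξ := by
    rw [Omega_apply, ← Finset.sum_sub_distrib, Finset.sum_mul]
    refine Finset.sum_congr rfl fun j _ => ?_
    rw [fderiv_gaussian hs, hb]
    field_simp
  rw [h3, h2, ← Finset.sum_sub_distrib]
  simp only [gaussSymbol_apply, Pi.sub_apply, sub_mul]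

theorem Omega_gaussian_congr {A : Matrix (Fin n) (Fin n) ℂ} (hs : A.IsSymm) (hA : ImPos A)
    {Y Z : Phase ℂ n} (h : gaussSymbol A Y = gaussSymbol A Z) :
    Omega Y (gaussian A hA) = Omega Z (gaussian A hA) := by
  ext ξ
  rw [Omega_gaussian_apply hs, Omega_gaussian_apply hs, h]

/-- The Fourier transform of a real Gaussian is positive. -/
theorem exists_integral_gaussian_pos {A : Matrix (Fin n) (Fin n) ℂ} (hA : ImPos A)
    (u : Fin n → ℝ) : ∃ r : ℝ, 0 < r ∧
      ∫ ξ : Fin n → ℝ, Complex.exp (-((quad A ξ).im : ℂ) + Complex.I * ((∑ j, u j * ξ j : ℝ) : ℂ))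
        = r := by
  set q : QuadraticForm ℝ (Fin n → ℝ) := (A.map Complex.im).toQuadraticForm' with hq
  have hqA : ∀ ξ, q ξ = (quad A ξ).im := fun ξ => by
    simp only [hq, Matrix.toQuadraticForm', LinearMap.BilinMap.toQuadraticMap_apply,
      Matrix.toLinearMap₂'_apply, quad, Complex.im_sum]
    refine Finset.sum_congr rfl fun j _ => Finset.sum_congr rfl fun k _ => ?_
    simp
    ring
  obtain ⟨w, ⟨e⟩⟩ := QuadraticForm.equivalent_weightedSumSquares q
  have he : ∀ ξ, (quad A ξ).im = ∑ i, w i * (e ξ i) ^ 2 := fun ξ => by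
    rw [← hqA, ← e.map_app, QuadraticMap.weightedSumSquares_apply]
    exact Finset.sum_congr rfl fun i _ => by rw [smul_eq_mul, sq]
  have hw : ∀ i, 0 < w i := fun i => by
    have h1 : e.toLinearEquiv.symm (Pi.single i 1) ≠ 0 := by
      simp
    have h2 := hA _ h1
    rw [he] at h2
    have h3 : e (e.toLinearEquiv.symm (Pi.single i 1)) = Pi.single i 1 :=
      e.toLinearEquiv.apply_symm_apply _
    rw [h3, Finset.sum_eq_single i] at h2
    · simpa using h2
    · intro j _ hj
      simp [hj]
    · simp
  -- The covector u in coordinates diagonalizing Im A; the integral then splits into one-dimensional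
  -- Gaussians with positive Fourier transforms.
  set c : Fin (Module.finrank ℝ (Fin n → ℝ)) → ℝ :=
    fun i => ∑ j, u j * e.toLinearEquiv.symm (Pi.single i 1) j with hc
  have hlin : ∀ ξ : Fin n → ℝ, ∑ j, u j * ξ j = ∑ i, c i * e ξ i := fun ξ => by
    have h1 : ξ = ∑ i, e ξ i • e.toLinearEquiv.symm (Pi.single i 1) := by
      simp only [← map_smul, ← map_sum]
      rw [LinearEquiv.eq_symm_apply]
      exact pi_eq_sum_univ' (e ξ)
    conv_lhs => rw [h1]
    simp only [hc, Finset.sum_apply, Pi.smul_apply, smul_eq_mul, Finset.mul_sum, Finset.sum_mul]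
    rw [Finset.sum_comm]
    exact Finset.sum_congr rfl fun i _ => Finset.sum_congr rfl fun j _ => by ring
  have hone : ∀ i, ∃ r : ℝ, 0 < r ∧ (Real.pi / (w i : ℂ)) ^ (1 / 2 : ℂ) *
      Complex.exp ((Complex.I * c i) ^ 2 / (4 * (w i : ℂ))) = r := fun i => by
    have hpw : 0 < Real.pi / w i := div_pos Real.pi_pos (hw i)
    refine ⟨(Real.pi / w i) ^ (1 / 2 : ℝ) * Real.exp (-(c i) ^ 2 / (4 * w i)),
      mul_pos (Real.rpow_pos_of_pos hpw _) (Real.exp_pos _), ?_⟩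
    rw [Complex.ofReal_mul, Complex.ofReal_cpow hpw.le, Complex.ofReal_exp, mul_pow, Complex.I_sq]
    push_cast
    rw [neg_one_mul]
  choose r hr0 hr using hone
  have hG := GaussianFourier.integral_cexp_neg_sum_mul_add (b := fun i => (w i : ℂ))
    (fun i => by simpa using hw i) (fun i => Complex.I * c i)
  simp only [hr] at hG
  let E : (Fin n → ℝ) ≃L[ℝ] (Fin (Module.finrank ℝ (Fin n → ℝ)) → ℝ) :=
    e.toLinearEquiv.toContinuousLinearEquiv
  have := E.isAddHaarMeasure_map (volume : Measure (Fin n → ℝ))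
  have hmap := integral_map_equiv (μ := (volume : Measure (Fin n → ℝ)))
    E.toHomeomorph.toMeasurableEquiv (fun v => Complex.exp
      (-∑ i, (w i : ℂ) * (v i : ℂ) ^ 2 + ∑ i, Complex.I * c i * v i))
  change ∫ y, _ ∂(Measure.map E volume) = _ at hmap
  -- Only positivity of the Jacobian matters, so uniqueness of Haar measure replaces a determinant.
  rw [Measure.isAddLeftInvariant_eq_smul (Measure.map E volume) volume, integral_smul_nnreal_measure,
    hG] at hmap
  refine ⟨Measure.addHaarScalarFactor (Measure.map E volume) volume * ∏ i, r i, mul_pos ?_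
    (Finset.prod_pos fun i _ => hr0 i), ?_⟩
  · exact_mod_cast Measure.addHaarScalarFactor_pos_of_isAddHaarMeasure _ _
  · rw [Complex.ofReal_mul, Complex.ofReal_prod]
    refine Eq.trans ?_ (hmap.symm.trans ?_)
    · refine integral_congr_ae (.of_forall fun ξ => ?_)
      change _ = Complex.exp (-∑ i, (w i : ℂ) * (e ξ i : ℂ) ^ 2 + ∑ i, Complex.I * c i * e ξ i)
      simp only [he, hlin]
      push_cast
      simp only [Finset.mul_sum, mul_assoc]
    · rfl

/-- Centring the integral at Q/2 cancels the Weyl phase P·Q/2 and leaves a real Gaussian times a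
purely imaginary linear exponential, up to a positive factor. -/
theorem exists_l2Inner_gaussian_weylOp_pos {A : Matrix (Fin n) (Fin n) ℂ} (hs : A.IsSymm)
    (hA : ImPos A) (X : Phase ℝ n) : ∃ r : ℝ, 0 < r ∧
      l2Inner (gaussian A hA) (weylOp X (gaussian A hA)) = r := by
  -- The frequency is P minus the contribution Re(A)Q of the cross terms between ξ and Q.
  obtain ⟨r, hr0, hr⟩ := exists_integral_gaussian_pos hA
    (fun k => X.1 k - ∑ j, X.2 j * (A j k).re)
  refine ⟨Real.exp (-(quad A X.2).im / 4) * r, mul_pos (Real.exp_pos _) hr0, ?_⟩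
  rw [Complex.ofReal_mul, ← hr, ← integral_const_mul, l2Inner,
    ← integral_add_right_eq_self _ ((1 / 2 : ℝ) • X.2)]
  refine integral_congr_ae (.of_forall fun ξ => ?_)
  simp only [weylOp_apply, weylPhase, gaussian_apply, ← Complex.exp_conj, Complex.ofReal_exp,
    ← Complex.exp_add]
  congr 1
  have hsub : ξ + (1 / 2 : ℝ) • X.2 - X.2 = ξ + (-(1 / 2) : ℝ) • X.2 := by
    ext j
    simp only [Pi.sub_apply, Pi.add_apply, Pi.smul_apply, smul_eq_mul]
    ring
  have hB : ∀ t : ℝ, quad A (ξ + t • X.2) = quad A ξ + 2 * (t * bilin A X.2 ξ)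
      + (t : ℂ) ^ 2 * quad A X.2 := fun t => by
    rw [quad_add hs, quad_smul, bilin_comm hs, bilin_smul_right, bilin_comm hs]
  have hre : (bilin A X.2 ξ).re = ∑ k, (∑ j, X.2 j * (A j k).re) * ξ k := by
    simp only [bilin, Complex.re_sum, Finset.sum_mul]
    rw [Finset.sum_comm]
    refine Finset.sum_congr rfl fun j _ => Finset.sum_congr rfl fun k _ => ?_
    simp
  have hP : ∑ j, X.1 j * (ξ + (1 / 2 : ℝ) • X.2) j
      = ∑ j, X.1 j * ξ j + (∑ j, X.1 j * X.2 j) / 2 := by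
    rw [Finset.sum_div, ← Finset.sum_add_distrib]
    refine Finset.sum_congr rfl fun j _ => ?_
    simp only [Pi.add_apply, Pi.smul_apply, smul_eq_mul]
    ring
  have hu : ∑ k, (X.1 k - ∑ j, X.2 j * (A j k).re) * ξ k
      = ∑ j, X.1 j * ξ j - (bilin A X.2 ξ).re := by
    rw [hre, ← Finset.sum_sub_distrib]
    exact Finset.sum_congr rfl fun k _ => by ring
  rw [hsub, hB, hB, hP, hu]
  have hq : conj (quad A ξ) = quad A ξ - 2 * (quad A ξ).im * Complex.I := by
    apply Complex.ext <;> simp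
    ring
  have hp : conj (quad A X.2) = quad A X.2 - 2 * (quad A X.2).im * Complex.I := by
    apply Complex.ext <;> simp
    ring
  have hb : conj (bilin A X.2 ξ) = 2 * (bilin A X.2 ξ).re - bilin A X.2 ξ := by
    apply Complex.ext <;> simp
    ring
  simp only [map_mul, map_div₀, map_add, map_pow, Complex.conj_I, Complex.conj_ofReal,
    Complex.conj_ofNat, hq, hp, hb]
  push_cast
  linear_combination ((quad A ξ).im + (quad A X.2).im / 4 : ℂ) * Complex.I_sq

theorem l2Inner_gaussian_self_ne_zero {A : Matrix (Fin n) (Fin n) ℂ} (hs : A.IsSymm)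
    (hA : ImPos A) : l2Inner (gaussian A hA) (gaussian A hA) ≠ 0 := by
  obtain ⟨r, hr0, hr⟩ := exists_l2Inner_gaussian_weylOp_pos hs hA 0
  rw [weylOp_zero] at hr
  rw [hr]
  exact_mod_cast hr0.ne'

/-- The integrand over L is strictly positive at every point, so averaging cannot cancel it. -/
theorem physInner_gaussian_self_ne_zero {L : Submodule ℝ (Phase ℝ n)} {μ : Measure L}
    [μ.IsAddHaarMeasure] {A : Matrix (Fin n) (Fin n) ℂ} (hs : A.IsSymm) (hA : ImPos A) :
    physInner L μ (gaussian A hA) (gaussian A hA) ≠ 0 := by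
  choose r hr0 hr using exists_l2Inner_gaussian_weylOp_pos hs hA
  have hint := (integrable_l2Inner_weylOp (L := L) (μ := μ) (gaussian A hA) (gaussian A hA)).re
  rw [physInner_eq]
  simp only [hr, RCLike.re_to_complex, Complex.ofReal_re] at hint ⊢
  rw [integral_complex_ofReal]
  have hpos : 0 < ∫ X : L, r X ∂μ := by
    rw [integral_pos_iff_support_of_nonneg (fun X : L => (hr0 X).le) hint]
    have : Function.support (fun X : L => r X) = Set.univ :=
      Set.eq_univ_of_forall fun X => (hr0 X).ne'
    rw [this]
    exact Measure.measure_univ_pos.2 (NeZero.ne μ)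
  exact_mod_cast hpos.ne'

/-! ### Lagrangian planes of Gaussian states -/

/-- The complexification of a real plane of phase space. -/
def complexSpan (L : Submodule ℝ (Phase ℝ n)) : Submodule ℂ (Phase ℂ n) :=
  Submodule.span ℂ (Phase.toComplex '' (L : Set (Phase ℝ n)))

theorem omega_toComplex (X X' : Phase ℝ n) :
    omega X.toComplex X'.toComplex = ((omega X X' : ℝ) : ℂ) := by
  simp [omega, Phase.toComplex]

theorem omega_zero_right {R : Type} [CommRing R] (X : Phase R n) : omega X 0 = 0 := by
  simp [omega]

theorem conj_add (Y Z : Phase ℂ n) : (Y + Z).conj = Y.conj + Z.conj := by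
  ext j <;> simp [Phase.conj]

theorem conj_smul (c : ℂ) (Y : Phase ℂ n) : (c • Y).conj = conj c • Y.conj := by
  ext j <;> simp [Phase.conj]

theorem conj_mem_complexSpan {L : Submodule ℝ (Phase ℝ n)} {Y : Phase ℂ n}
    (hY : Y ∈ complexSpan L) : Y.conj ∈ complexSpan L := by
  induction hY using Submodule.span_induction with
  | mem Y hY =>
    obtain ⟨X, hX, rfl⟩ := hY
    rw [Phase.conj_toComplex]
    exact Submodule.subset_span ⟨X, hX, rfl⟩
  | zero =>
    convert zero_mem (complexSpan L)
    ext j <;> simp [Phase.conj]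
  | add Y Z _ _ hY hZ =>
    rw [conj_add]
    exact add_mem hY hZ
  | smul c Y _ hY =>
    rw [conj_smul]
    exact Submodule.smul_mem _ _ hY

theorem omega_eq_zero_of_mem_complexSpan {L : Submodule ℝ (Phase ℝ n)} {Y : Phase ℂ n}
    (hY : ∀ X ∈ L, omega Y X.toComplex = 0) {Z : Phase ℂ n} (hZ : Z ∈ complexSpan L) :
    omega Y Z = 0 := by
  induction hZ using Submodule.span_induction with
  | mem Z hZ =>
    obtain ⟨X, hX, rfl⟩ := hZ
    exact hY X hX
  | zero => exact omega_zero_right Y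
  | add Z Z' _ _ hZ hZ' => rw [omega_add_right, hZ, hZ', add_zero]
  | smul c Z _ hZ => rw [omega_smul_right, hZ, mul_zero]

theorem omega_eq_zero_of_isIsotropic {L : Submodule ℝ (Phase ℝ n)} (hL : IsIsotropic L)
    {Y Z : Phase ℂ n} (hY : Y ∈ complexSpan L) (hZ : Z ∈ complexSpan L) : omega Y Z = 0 := by
  refine omega_eq_zero_of_mem_complexSpan (fun X hX => ?_) hZ
  rw [omega_swap, neg_eq_zero]
  refine omega_eq_zero_of_mem_complexSpan (fun X' hX' => ?_) hY
  rw [omega_toComplex, hL X hX X' hX', Complex.ofReal_zero]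

/-- By symmetry of A the cross terms between Re Q and Im Q cancel, so positivity of Im A on real
vectors controls complex ones. -/
theorem sum_mulVec_mul_conj {A : Matrix (Fin n) (Fin n) ℂ} (hs : A.IsSymm) (Q : Fin n → ℂ) :
    ∑ j, A.mulVec Q j * conj (Q j)
      = quad A (fun j => (Q j).re) + quad A (fun j => (Q j).im) := by
  have h : ∑ j, A.mulVec Q j * conj (Q j)
      = quad A (fun j => (Q j).re) + quad A (fun j => (Q j).im)
        + Complex.I * (bilin A (fun j => (Q j).re) (fun j => (Q j).im)
          - bilin A (fun j => (Q j).im) (fun j => (Q j).re)) := by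
    simp only [Matrix.mulVec, dotProduct, quad, bilin, Finset.sum_mul, Finset.mul_sum,
      ← Finset.sum_add_distrib, ← Finset.sum_sub_distrib]
    refine Finset.sum_congr rfl fun j _ => Finset.sum_congr rfl fun k _ => ?_
    have hj : conj (Q j) = (Q j).re - (Q j).im * Complex.I := by
      apply Complex.ext <;> simp
    have hk : Q k = (Q k).re + (Q k).im * Complex.I := (Complex.re_add_im _).symm
    rw [hj]
    conv_lhs => rw [hk]
    linear_combination -A j k * (Q j).im * (Q k).im * Complex.I_sq
  rw [h, bilin_comm hs, sub_self, mul_zero, add_zero]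

theorem quad_im_nonneg {A : Matrix (Fin n) (Fin n) ℂ} (hA : ImPos A) (ξ : Fin n → ℝ) :
    0 ≤ (quad A ξ).im := by
  by_cases h : ξ = 0
  · simp [h, quad]
  · exact (hA ξ h).le

/-- The form `ω(Y, Ȳ)` on the Lagrangian plane `P = AQ`. -/
theorem omega_conj_self {A : Matrix (Fin n) (Fin n) ℂ} (hs : A.IsSymm) {Y : Phase ℂ n}
    (hY : gaussSymbol A Y = 0) :
    omega Y Y.conj = 2 * Complex.I *
      (((quad A fun j => (Y.2 j).re).im + (quad A fun j => (Y.2 j).im).im : ℝ) : ℂ) := by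
  have hY1 : Y.1 = A.mulVec Y.2 := sub_eq_zero.1 hY
  have h1 : omega Y Y.conj = (∑ j, A.mulVec Y.2 j * conj (Y.2 j))
      - conj (∑ j, A.mulVec Y.2 j * conj (Y.2 j)) := by
    simp only [omega, Phase.conj, hY1, map_sum, map_mul, Complex.conj_conj,
      Finset.sum_sub_distrib]
  rw [h1, sum_mulVec_mul_conj hs, Complex.sub_conj, Complex.add_im]
  push_cast
  ring

theorem eq_zero_of_omega_conj_self {A : Matrix (Fin n) (Fin n) ℂ} (hA : ImPos A)
    {Y : Phase ℂ n} (hY : gaussSymbol A Y = 0)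
    (h : (quad A fun j => (Y.2 j).re).im + (quad A fun j => (Y.2 j).im).im ≤ 0) : Y = 0 := by
  have h1 := quad_im_nonneg hA fun j => (Y.2 j).re
  have h2 := quad_im_nonneg hA fun j => (Y.2 j).im
  have hre : (fun j => (Y.2 j).re) = 0 := by
    by_contra h0
    linarith [hA _ h0]
  have him : (fun j => (Y.2 j).im) = 0 := by
    by_contra h0
    linarith [hA _ h0]
  have hY2 : Y.2 = 0 := by
    ext j
    exact Complex.ext (congrFun hre j) (congrFun him j)
  have hY1 : Y.1 = A.mulVec Y.2 := sub_eq_zero.1 hY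
  rw [hY2, Matrix.mulVec_zero] at hY1
  exact Prod.ext hY1 hY2

/-- Y ↦ symbol of Ȳ is antilinear; passing to the conjugate matrix makes it linear, so that
dimensions over ℂ can be compared. -/
theorem gaussSymbol_conj (A : Matrix (Fin n) (Fin n) ℂ) (Y : Phase ℂ n) :
    gaussSymbol A Y.conj = fun j => conj (gaussSymbol (A.map (starRingEnd ℂ)) Y j) := by
  ext j
  simp [gaussSymbol_apply, Phase.conj, Matrix.mulVec, dotProduct]

/-- For S = X + R the terms involving X drop out, so ω(S, S̄) = ω(R, R̄). On the plane P = AQ the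
form ω(Y, Ȳ)/i is positive definite. It is therefore nonnegative at R and at S̄, but ω(S̄, S) =
−ω(S, S̄) forces opposite signs; both R and S vanish. -/
theorem eq_zero_of_conj_symbol_eq_zero {L : Submodule ℝ (Phase ℝ n)} (hL : IsIsotropic L)
    {A : Matrix (Fin n) (Fin n) ℂ} (hs : A.IsSymm) (hA : ImPos A) {X R : Phase ℂ n}
    (hX : X ∈ complexSpan L) (hR : gaussSymbol A R = 0)
    (hRL : ∀ Z ∈ complexSpan L, omega R Z = 0) (h : gaussSymbol A (X + R).conj = 0) :
    X = 0 ∧ R = 0 := by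
  have hX' := conj_mem_complexSpan hX
  have h1 : omega X R.conj = 0 := by
    rw [← Phase.conj_conj X, omega_conj, omega_swap, hRL _ hX', neg_zero, map_zero]
  have h2 : omega (X + R) (X + R).conj = omega R R.conj := by
    rw [conj_add, omega_add_left, omega_add_right, omega_add_right, h1, hRL _ hX',
      omega_eq_zero_of_isIsotropic hL hX hX']
    ring
  have h3 : omega (X + R) (X + R).conj = -omega (X + R).conj (X + R).conj.conj := by
    rw [Phase.conj_conj, ← omega_swap]
  rw [h2, omega_conj_self hs hR, omega_conj_self hs h] at h3
  have h4 := congrArg Complex.im h3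
  simp only [Complex.neg_im, Complex.mul_im, Complex.mul_re, Complex.re_ofNat, Complex.im_ofNat,
    Complex.I_re, Complex.I_im, Complex.ofReal_re, Complex.ofReal_im, mul_zero, mul_one,
    zero_add, sub_self, add_zero] at h4
  have p1 := quad_im_nonneg hA fun j => (R.2 j).re
  have p2 := quad_im_nonneg hA fun j => (R.2 j).im
  have p3 := quad_im_nonneg hA fun j => ((X + R).conj.2 j).re
  have p4 := quad_im_nonneg hA fun j => ((X + R).conj.2 j).im
  have hR0 : R = 0 := eq_zero_of_omega_conj_self hA hR (by linarith)
  have hS0 : (X + R).conj = 0 := eq_zero_of_omega_conj_self hA h (by linarith)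
  refine ⟨?_, hR0⟩
  rw [hR0, add_zero] at hS0
  rw [← Phase.conj_conj X, hS0]
  ext j <;> simp [Phase.conj]

/-- The pairing of the Lagrangian plane `P = AQ` with the complexification of `L`. -/
def lagrangianPairing (L : Submodule ℝ (Phase ℝ n)) (A : Matrix (Fin n) (Fin n) ℂ) :
    (Fin n → ℂ) →ₗ[ℂ] Module.Dual ℂ (complexSpan L) :=
  LinearMap.mk₂ ℂ (fun Q X => omega (A.mulVec Q, Q) (X : Phase ℂ n))
    (fun Q Q' X => by
      rw [← omega_add_left, Matrix.mulVec_add]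
      rfl)
    (fun c Q X => by
      rw [smul_eq_mul, ← omega_smul_left, Matrix.mulVec_smul]
      rfl)
    (fun Q X X' => omega_add_right _ _ _)
    (fun c Q X => omega_smul_right _ _ _)

/-- The map sending `X + (AQ, Q)` to the symbol for the conjugate matrix. -/
def conjSymbolMap (L : Submodule ℝ (Phase ℝ n)) (A : Matrix (Fin n) (Fin n) ℂ) :
    (complexSpan L × LinearMap.ker (lagrangianPairing L A)) →ₗ[ℂ] (Fin n → ℂ) :=
  gaussSymbol (A.map (starRingEnd ℂ)) ∘ₗ
    ((complexSpan L).subtype.coprod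
      ((A.mulVecLin.prod LinearMap.id) ∘ₗ (LinearMap.ker (lagrangianPairing L A)).subtype))

theorem conjSymbolMap_apply (L : Submodule ℝ (Phase ℝ n)) (A : Matrix (Fin n) (Fin n) ℂ)
    (p : complexSpan L × LinearMap.ker (lagrangianPairing L A)) :
    conjSymbolMap L A p = gaussSymbol (A.map (starRingEnd ℂ))
      ((p.1 : Phase ℂ n) + (A.mulVec (p.2 : Fin n → ℂ), (p.2 : Fin n → ℂ))) := rfl

theorem gaussSymbol_lagrangian (A : Matrix (Fin n) (Fin n) ℂ) (Q : Fin n → ℂ) :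
    gaussSymbol A (A.mulVec Q, Q) = 0 := by
  simp [gaussSymbol_apply]

theorem conjSymbolMap_surjective {L : Submodule ℝ (Phase ℝ n)} (hL : IsIsotropic L)
    {A : Matrix (Fin n) (Fin n) ℂ} (hs : A.IsSymm) (hA : ImPos A) :
    Function.Surjective (conjSymbolMap L A) := by
  have hinj : Function.Injective (conjSymbolMap L A) := by
    rw [injective_iff_map_eq_zero]
    rintro ⟨X, Q⟩ h
    rw [conjSymbolMap_apply] at h
    have h' : gaussSymbol A ((X : Phase ℂ n) + (A.mulVec (Q : Fin n → ℂ), (Q : Fin n → ℂ))).conj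
        = 0 := by
      rw [gaussSymbol_conj, h]
      ext j
      simp
    obtain ⟨h1, h2⟩ := eq_zero_of_conj_symbol_eq_zero hL hs hA X.2
      (gaussSymbol_lagrangian A Q)
      (fun Z hZ => LinearMap.congr_fun (LinearMap.mem_ker.1 Q.2) ⟨Z, hZ⟩) h'
    exact Prod.ext (Subtype.ext h1) (Subtype.ext (Prod.ext_iff.1 h2).2)
  -- Being skew to L imposes at most dim L conditions on the plane P = AQ, so the source has
  -- dimension at least n; injectivity gives at most n.
  have hle := LinearMap.finrank_le_finrank_of_injective hinj
  have hrank := LinearMap.finrank_range_add_finrank_ker (lagrangianPairing L A)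
  have hrange := Submodule.finrank_le (LinearMap.range (lagrangianPairing L A))
  rw [Subspace.dual_finrank_eq] at hrange
  rw [Module.finrank_prod] at hle
  refine (LinearMap.injective_iff_surjective_of_finrank_eq_finrank ?_).1 hinj
  rw [Module.finrank_prod]
  omega

/-- Every symbol is that of the conjugate of an element of the H-germ. -/
theorem exists_mem_hGerm_symbol_conj {L : Submodule ℝ (Phase ℝ n)} (hL : IsIsotropic L)
    (μ : Measure L) [μ.IsAddHaarMeasure] {A : Matrix (Fin n) (Fin n) ℂ} (hs : A.IsSymm)
    (hA : ImPos A) (l : Fin n → ℂ) :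
    ∃ Y ∈ hGerm L μ A hA, gaussSymbol A Y.conj = l := by
  obtain ⟨⟨X, Q⟩, h⟩ := conjSymbolMap_surjective hL hs hA fun j => conj (l j)
  rw [conjSymbolMap_apply] at h
  refine ⟨(X : Phase ℂ n) + (A.mulVec (Q : Fin n → ℂ), (Q : Fin n → ℂ)),
    ⟨fun Z hZ => ?_, ?_⟩, (gaussSymbol_conj A _).trans ?_⟩
  · have hZ' : Z.toComplex ∈ complexSpan L := Submodule.subset_span ⟨Z, hZ, rfl⟩
    rw [omega_add_left, omega_eq_zero_of_isIsotropic hL X.2 hZ', zero_add]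
    exact LinearMap.congr_fun (LinearMap.mem_ker.1 Q.2) ⟨_, hZ'⟩
  -- The Lagrangian part kills the Gaussian exactly; the part from L gives a constraint, hence a
  -- null vector.
  · have hsym : gaussSymbol A ((X : Phase ℂ n) + (A.mulVec (Q : Fin n → ℂ), (Q : Fin n → ℂ)))
        = gaussSymbol A (X : Phase ℂ n) := by
      rw [map_add, gaussSymbol_lagrangian, add_zero]
    rw [Omega_gaussian_congr hs hA hsym]
    exact isNull_Omega_of_mem_span hL X.2 _
  · rw [h]
    ext j
    simp

/-! ### The H-germ determines the Gaussian state -/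

/-- The integrating factor e^{−κt²/2} turns h into a constant. -/
theorem eq_zero_of_hasDerivAt_mul_self {h : ℝ → ℂ} {κ : ℂ}
    (hd : ∀ t : ℝ, HasDerivAt h (t * κ * h t) t) (h0 : h 0 = 0) (t : ℝ) : h t = 0 := by
  have hE : ∀ t : ℝ, HasDerivAt (fun t : ℝ => Complex.exp (-(κ / 2 * (t : ℂ) ^ 2)))
      (Complex.exp (-(κ / 2 * (t : ℂ) ^ 2)) * (-(κ / 2 * (2 * (t : ℂ))))) t := fun t => by
    have hid : HasDerivAt (fun t : ℝ => (t : ℂ)) 1 t := (hasDerivAt_id t).ofReal_comp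
    have := (((hid.pow 2).const_mul (κ / 2)).neg).cexp
    simpa using this
  have hc : ∀ t : ℝ, HasDerivAt (fun t : ℝ => h t * Complex.exp (-(κ / 2 * (t : ℂ) ^ 2))) 0 t :=
    fun t => by
      refine ((hd t).mul (hE t)).congr_deriv ?_
      ring
  have hconst := is_const_of_deriv_eq_zero (fun t => (hc t).differentiableAt)
    (fun t => (hc t).deriv) t 0
  simp only [h0, zero_mul] at hconst
  exact (mul_eq_zero.1 hconst).resolve_right (Complex.exp_ne_zero _)

theorem toComplex_smul (t : ℝ) (Z : Phase ℝ n) : (t • Z).toComplex = (t : ℂ) • Z.toComplex := by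
  ext j <;> simp [Phase.toComplex]

theorem hGerm_symPart (L : Submodule ℝ (Phase ℝ n)) (μ : Measure L)
    (A : Matrix (Fin n) (Fin n) ℂ) (hA : ImPos A) :
    hGerm L μ (symPart A) hA.symPart = hGerm L μ A hA := by
  rw [hGerm, hGerm, gaussian_symPart A hA]

section Main

variable {L : Submodule ℝ (Phase ℝ n)} {μ : Measure L} [μ.IsAddHaarMeasure]

/-- A vector annihilated by the H-germ of `ψ_A` and orthogonal to `ψ_A` is null. -/
theorem isNull_of_annihilated_of_orthogonal (hL : IsIsotropic L)
    {A : Matrix (Fin n) (Fin n) ℂ} (hs : A.IsSymm) (hA : ImPos A) {f : 𝓢(Fin n → ℝ, ℂ)}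
    (hf : ∀ Y ∈ hGerm L μ A hA, IsNull L μ (Omega Y f))
    (h0 : physInner L μ (gaussian A hA) f = 0) : IsNull L μ f := by
  refine isNull_of_physInner_weylOp_eq_zero (l2Inner_gaussian_self_ne_zero hs hA) fun Z => ?_
  -- Ω(Z)ψ = Ω(Ȳ)ψ, and the adjoint of Ω(Ȳ) is Ω(Y), which annihilates f modulo null vectors.
  obtain ⟨Y, hY, hYZ⟩ := exists_mem_hGerm_symbol_conj hL μ hs hA (gaussSymbol A Z.toComplex)
  have hYL : ∀ X ∈ L, omega Y.conj X.toComplex = 0 := fun X hX => by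
    rw [← Phase.conj_toComplex, omega_conj, hY.1 X hX, map_zero]
  have hd : ∀ t : ℝ, HasDerivAt (fun s : ℝ => physInner L μ (weylOp (s • Z) (gaussian A hA)) f)
      (t * (Complex.I * conj (omega Y.conj Z.toComplex)) *
        physInner L μ (weylOp (t • Z) (gaussian A hA)) f) t := by
    intro t
    refine (physInner_weylOp_smul_hasDerivAt Z (gaussian A hA) f t).congr_deriv ?_
    have h1 : weylOp (t • Z) (Omega Z.toComplex (gaussian A hA))
        = Omega Y.conj (weylOp (t • Z) (gaussian A hA))
          + (-(t * omega Y.conj Z.toComplex)) • weylOp (t • Z) (gaussian A hA) := by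
      rw [Omega_weylOp, ← Omega_gaussian_congr hs hA hYZ, toComplex_smul, omega_smul_right,
        neg_smul, add_neg_cancel_right]
    rw [map_smul, h1, physInner_smul_left, physInner_add_left, physInner_smul_left,
      physInner_Omega_left hYL, Phase.conj_conj, (hf Y hY).physInner_right hL]
    simp only [Complex.conj_I, map_neg, map_mul, Complex.conj_ofReal]
    ring
  have h := eq_zero_of_hasDerivAt_mul_self hd (by rwa [zero_smul, weylOp_zero]) 1
  rwa [one_smul] at h

theorem hGerm_eq_iff_of_isSymm (hL : IsIsotropic L) {A₁ A₂ : Matrix (Fin n) (Fin n) ℂ}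
    (hs₁ : A₁.IsSymm) (hs₂ : A₂.IsSymm) (hA₁ : ImPos A₁) (hA₂ : ImPos A₂) {c₁ c₂ : ℂ}
    (hc₁ : c₁ ≠ 0) (hc₂ : c₂ ≠ 0) :
    hGerm L μ A₁ hA₁ = hGerm L μ A₂ hA₂ ↔
      ∃ c : ℂ, PhysEquiv L μ (c₁ • gaussian A₁ hA₁) (c • (c₂ • gaussian A₂ hA₂)) := by
  constructor
  · intro hg
    have h2 : physInner L μ (gaussian A₂ hA₂) (gaussian A₂ hA₂) ≠ 0 :=
      physInner_gaussian_self_ne_zero hs₂ hA₂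
    -- The coefficient of the orthogonal projection onto the second Gaussian.
    set b := physInner L μ (gaussian A₂ hA₂) (gaussian A₁ hA₁) /
      physInner L μ (gaussian A₂ hA₂) (gaussian A₂ hA₂) with hb
    have hnull : IsNull L μ (gaussian A₁ hA₁ + (-b) • gaussian A₂ hA₂) := by
      refine isNull_of_annihilated_of_orthogonal hL hs₂ hA₂ (fun Y hY => ?_) ?_
      · rw [map_add, map_smul, ← mem_nullSubmodule hL]
        refine add_mem ?_ (Submodule.smul_mem _ _ hY.2)
        rw [← hg] at hY
        exact hY.2
      · rw [physInner_add_right, physInner_smul_right, hb]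
        field_simp
        ring
    refine ⟨c₁ * b / c₂, ?_⟩
    have heq : c₁ • gaussian A₁ hA₁ - (c₁ * b / c₂) • (c₂ • gaussian A₂ hA₂)
        = c₁ • (gaussian A₁ hA₁ + (-b) • gaussian A₂ hA₂) := by
      rw [smul_smul, div_mul_cancel₀ _ hc₂, smul_add, smul_smul, mul_neg, neg_smul, sub_eq_add_neg]
    rw [PhysEquiv, heq]
    exact (nullSubmodule hL μ).smul_mem c₁ hnull
  · rintro ⟨c, hc⟩
    -- With c = 0 the first Gaussian would be null.
    have hc0 : c ≠ 0 := by
      rintro rfl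
      rw [PhysEquiv, zero_smul, sub_zero, ← mem_nullSubmodule hL,
        Submodule.smul_mem_iff _ hc₁] at hc
      exact physInner_gaussian_self_ne_zero hs₁ hA₁ hc
    ext Y
    refine and_congr_right fun hY => ?_
    have h := IsNull.Omega hL hY hc
    rw [← mem_nullSubmodule hL, map_sub, map_smul, map_smul, map_smul] at h
    have h1 := Submodule.smul_mem_iff (nullSubmodule hL μ) hc₁
      (x := Omega Y (gaussian A₁ hA₁))
    have h2 := Submodule.smul_mem_iff (nullSubmodule hL μ) hc0
      (x := c₂ • Omega Y (gaussian A₂ hA₂))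
    rw [Submodule.smul_mem_iff _ hc₂] at h2
    refine h1.symm.trans (Iff.trans ⟨fun h3 => ?_, fun h3 => ?_⟩ h2)
    · simpa using sub_mem h3 h
    · simpa using add_mem h h3

end Main

end Constrained

end

/-- The matrices need not be symmetric, but the Gaussian, and with it the germ, depends only on the
symmetric part. -/
theorem lemma13 {n : ℕ}
    (L : Submodule ℝ (Constrained.Phase ℝ n)) (hL : Constrained.IsIsotropic L)
    (μ : MeasureTheory.Measure L) [μ.IsAddHaarMeasure]
    (A₁ A₂ : Matrix (Fin n) (Fin n) ℂ)
    (hA₁ : Constrained.ImPos A₁) (hA₂ : Constrained.ImPos A₂)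
    (c₁ c₂ : ℂ) (hc₁ : c₁ ≠ 0) (hc₂ : c₂ ≠ 0) :
    Constrained.hGerm L μ A₁ hA₁ = Constrained.hGerm L μ A₂ hA₂ ↔
      ∃ c : ℂ, Constrained.PhysEquiv L μ
        (c₁ • Constrained.gaussian A₁ hA₁) (c • (c₂ • Constrained.gaussian A₂ hA₂)) := by
  have h := Constrained.hGerm_eq_iff_of_isSymm (μ := μ) hL (Constrained.symPart_isSymm A₁)
    (Constrained.symPart_isSymm A₂) hA₁.symPart hA₂.symPart hc₁ hc₂
  rwa [Constrained.hGerm_symPart L μ A₁ hA₁, Constrained.hGerm_symPart L μ A₂ hA₂,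
    Constrained.gaussian_symPart A₁ hA₁, Constrained.gaussian_symPart A₂ hA₂] at h
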